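/- Work in an arbitrary countably saturated nonstandard universe (a star map on the standard objects of finite type over $\mathbb N$ satisfying the transfer principle and such that every countable family of internal sets with the finite intersection property has nonempty intersection). *Borel* subsets of an internal set are the members of the least $\sigma$-algebra containing all its internal subsets. A set is *countably determined* (CD) if it has the form $$\bigcup_{b\in B}\Bigl(\bigcap_{m\in b}X_m\cap\bigcap_{m\in\mathbb N\setminus b}\bigl(\textstyle\bigcup_n X_n\setminus X_m\bigr)\Bigr)$$ with all $X_m$ ($m\in\mathbb N$) internal and $B\subseteq\mathcal P(\mathbb N)$. For equivalence relations $\mathsf E,\mathsf F$ on sets $X,Y$, write $\mathsf E\le_B\mathsf F$ (resp. $\mathsf E\le_{CD}\mathsf F$) if there is a map $\vartheta:X\to Y$ with Borel (resp. CD) graph such that $x\,\mathsf E\,x'\iff\vartheta(x)\,\mathsf F\,\vartheta(x')$ for all $x,x'\in X$; write $\mathsf E<_B\mathsf F$ if $\mathsf E\le_B\mathsf F$ and not $\mathsf F\le_B\mathsf E$. A set $U\subseteq{}^*\mathbb N$ is a *countably cofinal* (resp. *countably coinitial*) cut if $U=\bigcup_{n\in\mathbb N}[0,a_n)$ for a strictly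 increasing (resp. $U=\bigcap_{n\in\mathbb N}[0,a_n)$ for a strictly decreasing) sequence $(a_n)_{n\in\mathbb N}$ in ${}^*\mathbb N$; it is *additive* if $x+y\in U$ whenever $x,y\in U$. For an additive cut $U$ let $\mathsf E_U$ be the equivalence relation on ${}^*\mathbb N$ given by $x\,\mathsf E_U\,y\iff|x-y|\in U$. Let $\mathsf{FD}$ be the equivalence relation on the set of all hyperfinite (internal) subsets of ${}^*\mathbb N$ given by $u\,\mathsf{FD}\,v\iff u\,\triangle\,v$ is finite. Then: 1. if $U\subseteq{}^*\mathbb N$ is an additive countably cofinal cut, then $\mathsf E_U\le_B\mathsf{FD}$, and moreover $\mathsf E_U<_B\mathsf{FD}$; 2. if $V\subseteq{}^*\mathbb N$ is an additive countably coinitial cut, then $\mathsf E_V\not\le_{CD}\mathsf{FD}$. -/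

import Mathlib

universe u

/-! ## Nonstandard universes

The finite types over `ℕ` (natural numbers, sets, ordered pairs), the first-order language of
membership and ordered pairs over them (every quantifier ranges over one finite type, that is, it is
a bounded quantifier), and countably saturated nonstandard universes: a star map from the standard
objects of all finite types to the internal ones that satisfies transfer and countable saturation. -/

namespace NSA

/-- Finite types over `ℕ`. -/
inductive Ty : Type
  | nat : Ty
  | set : Ty → Ty
  | prod : Ty → Ty → Ty

/-- The standard objects of a given finite type. -/
@[reducible] def Ty.Std : Ty → Type
  | .nat => ℕ
  | .set τ => Set τ.Std
  | .prod σ τ => σ.Std × τ.Std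

/-- Variables (de Bruijn indices) of type `τ` in a context. -/
inductive Var : List Ty → Ty → Type
  | zero {Γ : List Ty} {τ : Ty} : Var (τ :: Γ) τ
  | succ {Γ : List Ty} {σ τ : Ty} : Var Γ τ → Var (σ :: Γ) τ

/-- Terms: variables, constants for all standard objects, ordered pairs. -/
inductive Term (Γ : List Ty) : Ty → Type
  | var {τ : Ty} : Var Γ τ → Term Γ τ
  | const {τ : Ty} : τ.Std → Term Γ τ
  | pair {σ τ : Ty} : Term Γ σ → Term Γ τ → Term Γ (.prod σ τ)

/-- Formulas of the language of membership with variables from the context `Γ`. -/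
inductive Formula : List Ty → Type
  | eq {Γ : List Ty} {τ : Ty} : Term Γ τ → Term Γ τ → Formula Γ
  | mem {Γ : List Ty} {τ : Ty} : Term Γ τ → Term Γ (.set τ) → Formula Γ
  | neg {Γ : List Ty} : Formula Γ → Formula Γ
  | and {Γ : List Ty} : Formula Γ → Formula Γ → Formula Γ
  | or {Γ : List Ty} : Formula Γ → Formula Γ → Formula Γ
  | imp {Γ : List Ty} : Formula Γ → Formula Γ → Formula Γ
  | all {Γ : List Ty} (τ : Ty) : Formula (τ :: Γ) → Formula Γ
  | ex {Γ : List Ty} (τ : Ty) : Formula (τ :: Γ) → Formula Γ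

/-- An interpretation of the language. -/
structure Interp where
  /-- the objects of each finite type -/
  Obj : Ty → Type u
  /-- the value of the constant for a standard object -/
  star : {τ : Ty} → τ.Std → Obj τ
  /-- membership -/
  mem : {τ : Ty} → Obj τ → Obj (.set τ) → Prop
  /-- ordered pairs -/
  pair : {σ τ : Ty} → Obj σ → Obj τ → Obj (.prod σ τ)

/-- The standard interpretation. -/
def standard : Interp.{0} where
  Obj := Ty.Std
  star := fun x => x
  mem := fun {τ} (x : τ.Std) (A : Set τ.Std) => x ∈ A
  pair := fun x y => (x, y)

/-- Assignments of values to the variables of a context. -/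
def Env (M : Interp.{u}) (Γ : List Ty) : Type u := (τ : Ty) → Var Γ τ → M.Obj τ

/-- The assignment to the empty context. -/
def Env.nil (M : Interp.{u}) : Env M [] := fun _ i => nomatch i

/-- Extension of an assignment by a value of a new variable. -/
def Env.cons {M : Interp.{u}} {Γ : List Ty} {σ : Ty} (x : M.Obj σ) (v : Env M Γ) :
    Env M (σ :: Γ)
  | _, .zero => x
  | τ, .succ i => v τ i

/-- The value of a term. -/
def Term.eval {M : Interp.{u}} {Γ : List Ty} (v : Env M Γ) : {τ : Ty} → Term Γ τ → M.Obj τ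
  | τ, .var i => v τ i
  | _, .const c => M.star c
  | _, .pair s t => M.pair (s.eval v) (t.eval v)

/-- Tarski's definition of truth of a formula under an assignment. -/
def Formula.Holds (M : Interp.{u}) : {Γ : List Ty} → Formula Γ → Env M Γ → Prop
  | _, .eq s t, v => s.eval v = t.eval v
  | _, .mem s t, v => M.mem (s.eval v) (t.eval v)
  | _, .neg φ, v => ¬ φ.Holds M v
  | _, .and φ ψ, v => φ.Holds M v ∧ ψ.Holds M v
  | _, .or φ ψ, v => φ.Holds M v ∨ ψ.Holds M v
  | _, .imp φ ψ, v => φ.Holds M v → ψ.Holds M v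
  | _, .all τ φ, v => ∀ x : M.Obj τ, φ.Holds M (v.cons x)
  | _, .ex τ φ, v => ∃ x : M.Obj τ, φ.Holds M (v.cons x)

/-- A countably saturated nonstandard universe (its internal objects of finite type). Countable
saturation implies that the extension is proper. -/
structure Universe extends Interp.{u} where
  /-- Transfer: a sentence with constants for standard objects is true in the standard
  universe iff its star-version is true in the nonstandard one. -/
  transfer : ∀ φ : Formula [],
    φ.Holds standard (Env.nil standard) ↔ φ.Holds toInterp (Env.nil toInterp)
  /-- Countable saturation: every sequence of internal sets all of whose finite
  subfamilies have a common element has a common element. -/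
  saturated : ∀ (τ : Ty) (A : ℕ → Obj (.set τ)),
    (∀ n : ℕ, ∃ x : Obj τ, ∀ i ≤ n, mem x (A i)) → ∃ x : Obj τ, ∀ i : ℕ, mem x (A i)

namespace Universe

variable (U : Universe.{u})

/-- The graph of a standard function as a standard set of pairs. -/
def stdGraph {σ τ : Ty} (f : σ.Std → τ.Std) : (Ty.set (.prod σ τ)).Std :=
  {p : σ.Std × τ.Std | p.2 = f p.1}

/-- The star-extension of the graph of a function is the graph of a function. -/
theorem exists_app {σ τ : Ty} (f : σ.Std → τ.Std) (x : U.Obj σ) :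
    ∃ y : U.Obj τ, U.mem (U.pair x y) (U.star (stdGraph f)) :=
  (U.transfer (.all σ (.ex τ (.mem (.pair (.var (.succ .zero)) (.var .zero))
    (.const (stdGraph f)))))).1 (fun x => ⟨f x, rfl⟩) x

theorem app_unique {σ τ : Ty} (f : σ.Std → τ.Std) (x : U.Obj σ) (y y' : U.Obj τ)
    (h : U.mem (U.pair x y) (U.star (stdGraph f)))
    (h' : U.mem (U.pair x y') (U.star (stdGraph f))) : y = y' :=
  (U.transfer (.all σ (.all τ (.all τ
    (.imp (.mem (.pair (.var (.succ (.succ .zero))) (.var (.succ .zero))) (.const (stdGraph f)))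
    (.imp (.mem (.pair (.var (.succ (.succ .zero))) (.var .zero)) (.const (stdGraph f)))
      (.eq (.var (.succ .zero)) (.var .zero)))))))).1
    (fun _ _ _ h h' => Eq.trans h (Eq.symm h')) x y y' h h'

/-- The star-extension of a standard function. -/
noncomputable def app {σ τ : Ty} (f : σ.Std → τ.Std) (x : U.Obj σ) : U.Obj τ :=
  (U.exists_app f x).choose

theorem app_spec {σ τ : Ty} (f : σ.Std → τ.Std) (x : U.Obj σ) :
    U.mem (U.pair x (U.app f x)) (U.star (stdGraph f)) :=
  (U.exists_app f x).choose_spec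

/-! ## Hyperintegers and cuts -/

/-- The set of hyperintegers (the star-extension of `ℕ`). -/
abbrev HNat : Type u := U.Obj .nat

/-- Addition of hyperintegers. -/
noncomputable def add (x y : U.HNat) : U.HNat :=
  U.app (σ := .prod .nat .nat) (τ := .nat) (fun p : ℕ × ℕ => p.1 + p.2) (U.pair x y)

/-- The distance `|x - y|` of hyperintegers (natural subtraction truncates, so that one of
the two summands is the distance and the other one is zero). -/
noncomputable def dist (x y : U.HNat) : U.HNat :=
  U.app (σ := .prod .nat .nat) (τ := .nat) (fun p : ℕ × ℕ => (p.1 - p.2) + (p.2 - p.1))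
    (U.pair x y)

/-- The order of hyperintegers. -/
def lt (x y : U.HNat) : Prop :=
  U.mem (U.pair x y) (U.star (τ := .set (.prod .nat .nat)) {p : ℕ × ℕ | p.1 < p.2})

/-- `C` is closed under addition. -/
def IsAdditive (C : Set U.HNat) : Prop :=
  ∀ x ∈ C, ∀ y ∈ C, U.add x y ∈ C

/-- Countably cofinal cuts: unions of intervals `[0, a n)` for strictly increasing `a`. -/
def IsCountablyCofinalCut (C : Set U.HNat) : Prop :=
  ∃ a : ℕ → U.HNat, (∀ n, U.lt (a n) (a (n + 1))) ∧ C = {x | ∃ n, U.lt x (a n)}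

/-- Countably coinitial cuts: intersections of intervals `[0, a n)` for strictly
decreasing `a`. -/
def IsCountablyCoinitialCut (C : Set U.HNat) : Prop :=
  ∃ a : ℕ → U.HNat, (∀ n, U.lt (a (n + 1)) (a n)) ∧ C = {x | ∀ n, U.lt x (a n)}

/-! ## Internal, Borel and countably determined sets -/

/-- Internal subsets of the internal set of all objects of type `τ`. -/
def IsInternal {τ : Ty} (s : Set (U.Obj τ)) : Prop :=
  ∃ A : U.Obj (.set τ), s = {x | U.mem x A}

/-- Borel sets: members of the least sigma-algebra that contains all internal sets. -/
def IsBorel {τ : Ty} (s : Set (U.Obj τ)) : Prop :=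
  @MeasurableSet (U.Obj τ)
    (MeasurableSpace.generateFrom {t : Set (U.Obj τ) | U.IsInternal t}) s

/-- Countably determined sets. -/
def IsCD {τ : Ty} (s : Set (U.Obj τ)) : Prop :=
  ∃ (X : ℕ → Set (U.Obj τ)) (B : Set (Set ℕ)), (∀ m, U.IsInternal (X m)) ∧
    s = ⋃ b ∈ B, ((⋂ m ∈ b, X m) ∩ ⋂ m ∈ bᶜ, ((⋃ n, X n) \ X m))

/-! ## Reducibility -/

/-- A binary relation together with its domain. -/
structure RelOn (τ : Ty) where
  /-- the domain -/
  dom : Set (U.Obj τ)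
  /-- the relation, of interest on the domain only -/
  rel : U.Obj τ → U.Obj τ → Prop

variable {U}

/-- The graph of a map between sets of objects. -/
def graph {σ τ : Ty} {X : Set (U.Obj σ)} {Y : Set (U.Obj τ)} (θ : X → Y) :
    Set (U.Obj (.prod σ τ)) :=
  {z | ∃ x : X, z = U.pair (x : U.Obj σ) (θ x : U.Obj τ)}

/-- `θ` is a reduction of `E` to `F`. -/
def IsReduction {σ τ : Ty} (E : U.RelOn σ) (F : U.RelOn τ) (θ : E.dom → F.dom) : Prop :=
  ∀ x x' : E.dom, E.rel x x' ↔ F.rel (θ x) (θ x')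

/-- Borel reducibility. -/
def BorelLE {σ τ : Ty} (E : U.RelOn σ) (F : U.RelOn τ) : Prop :=
  ∃ θ : E.dom → F.dom, U.IsBorel (graph θ) ∧ IsReduction E F θ

/-- Strict Borel reducibility. -/
def BorelLT {σ τ : Ty} (E : U.RelOn σ) (F : U.RelOn τ) : Prop :=
  BorelLE E F ∧ ¬ BorelLE F E

/-- Countably determined reducibility. -/
def CDLE {σ τ : Ty} (E : U.RelOn σ) (F : U.RelOn τ) : Prop :=
  ∃ θ : E.dom → F.dom, U.IsCD (graph θ) ∧ IsReduction E F θ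

variable (U)

/-- The monadic relation of a cut `C`, on all hyperintegers: `|x - y| ∈ C`. -/
def monadic (C : Set U.HNat) : U.RelOn .nat where
  dom := Set.univ
  rel := fun x y => U.dist x y ∈ C

/-- The internal set of all hyperfinite sets of hyperintegers (the star-extension of the set of
all finite sets of natural numbers). -/
def hyperfinite : Set (U.Obj (.set .nat)) :=
  {A | U.mem A (U.star (τ := .set (.set .nat)) {s : Set ℕ | s.Finite})}

/-- Equality of hyperfinite sets of hyperintegers modulo a finite set: the symmetric
difference is finite (in the external sense). -/
def FD : U.RelOn (.set .nat) where
  dom := U.hyperfinite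
  rel := fun A B => (symmDiff {x : U.HNat | U.mem x A} {x : U.HNat | U.mem x B}).Finite

end Universe

end NSA

/-!
Let the graph of `θ` be countably determined by internal sets `X m`, and let `R n` be a decreasing
sequence of internal relations such that no two points of the graph satisfy all of them. By
saturation, around each point of the graph some finite Boolean combination of the `X m` contains no
pair in some `R n`; there are only countably many such combinations, so countably many internal
sets cover the graph, each of them uniformly free of some `R n`.

* A cofinal cut `U` reduces to `FD`: fix a hyperfinite set `S` of exponents starting with a sequence
  `v 0 < v 1 < ⋯` for which `2 ^ v n` is cofinal in `U`, and send `x` to the set of its dyadic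
  levels with exponent in `S`. Two points closer than `2 ^ v n` differ in at most one level from
  `v n` on, while points whose distance is not in `U` differ in all levels `v n`.
* A coinitial cut `V` does not reduce to `FD`: the cover splits the hyperintegers into pieces on
  which distances below some `a n ∉ V` already belong to `V`. Any interval of length outside `V`
  has a quarter, again of length outside `V`, that avoids a given piece. Iterating and using
  saturation gives a point in no piece.
* `FD` does not reduce to a cofinal cut: by saturation finitely many pieces of the cover suffice. On
  each of them sets that differ in at most two elements have images at distance less than `l`, and
  sets that differ in at least `m` elements have images at distance at least `l`. By pigeonhole some
  piece contains the sets that code all words of length `N ≥ m` in `N + 2` letters. The `N + 2`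
  constant words, which differ in all `N` places, have images within `N * l` of one another, too
  close for `N + 2` points at mutual distance at least `l`.
-/

namespace NSA

/-! ## Function symbols -/

/-- Terms of the language expanded by a symbol for every standard function. -/
inductive FunTerm (Γ : List Ty) : Ty → Type
  | var {τ : Ty} : Var Γ τ → FunTerm Γ τ
  | const {τ : Ty} : τ.Std → FunTerm Γ τ
  | pair {σ τ : Ty} : FunTerm Γ σ → FunTerm Γ τ → FunTerm Γ (.prod σ τ)
  | app {σ τ : Ty} : (σ.Std → τ.Std) → FunTerm Γ σ → FunTerm Γ τ

/-- Formulas of the language expanded by a symbol for every standard function. They are a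
definitional extension of `Formula`; with them transfer applies to statements about star-extensions
of functions without mentioning graphs. -/
inductive FunFormula : List Ty → Type
  | eq {Γ : List Ty} {τ : Ty} : FunTerm Γ τ → FunTerm Γ τ → FunFormula Γ
  | mem {Γ : List Ty} {τ : Ty} : FunTerm Γ τ → FunTerm Γ (.set τ) → FunFormula Γ
  | neg {Γ : List Ty} : FunFormula Γ → FunFormula Γ
  | and {Γ : List Ty} : FunFormula Γ → FunFormula Γ → FunFormula Γ
  | or {Γ : List Ty} : FunFormula Γ → FunFormula Γ → FunFormula Γ
  | imp {Γ : List Ty} : FunFormula Γ → FunFormula Γ → FunFormula Γ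
  | iff {Γ : List Ty} : FunFormula Γ → FunFormula Γ → FunFormula Γ
  | all {Γ : List Ty} (τ : Ty) : FunFormula (τ :: Γ) → FunFormula Γ
  | ex {Γ : List Ty} (τ : Ty) : FunFormula (τ :: Γ) → FunFormula Γ

/-- An interpretation of the expanded language. -/
structure FunInterp extends Interp.{u} where
  /-- the value of the symbol for a standard function -/
  app : {σ τ : Ty} → (σ.Std → τ.Std) → Obj σ → Obj τ
  /-- the values of the symbol for a function are given by the constant for its graph -/
  eq_app_iff : ∀ {σ τ : Ty} (f : σ.Std → τ.Std) (x : Obj σ) (y : Obj τ),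
    y = app f x ↔ mem (pair x y) (star (τ := .set (.prod σ τ)) {p | p.2 = f p.1})

/-- The value of a term of the expanded language. -/
def FunTerm.eval {M : FunInterp.{u}} {Γ : List Ty} (v : Env M.toInterp Γ) :
    {τ : Ty} → FunTerm Γ τ → M.Obj τ
  | τ, .var i => v τ i
  | _, .const c => M.star c
  | _, .pair s t => M.pair (s.eval v) (t.eval v)
  | _, .app f t => M.app f (t.eval v)

/-- Truth of a formula of the expanded language under an assignment. -/
def FunFormula.Holds (M : FunInterp.{u}) : {Γ : List Ty} → FunFormula Γ → Env M.toInterp Γ → Prop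
  | _, .eq s t, v => s.eval v = t.eval v
  | _, .mem s t, v => M.mem (s.eval v) (t.eval v)
  | _, .neg φ, v => ¬ φ.Holds M v
  | _, .and φ ψ, v => φ.Holds M v ∧ ψ.Holds M v
  | _, .or φ ψ, v => φ.Holds M v ∨ ψ.Holds M v
  | _, .imp φ ψ, v => φ.Holds M v → ψ.Holds M v
  | _, .iff φ ψ, v => φ.Holds M v ↔ ψ.Holds M v
  | _, .all τ φ, v => ∀ x : M.Obj τ, φ.Holds M (v.cons x)
  | _, .ex τ φ, v => ∃ x : M.Obj τ, φ.Holds M (v.cons x)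

/-- Renamings of the variables of a context. -/
abbrev Renaming (Γ Δ : List Ty) : Type := (τ : Ty) → Var Γ τ → Var Δ τ

/-- The renaming that makes room for a new variable `0` in the target context. -/
def Renaming.weaken {Γ Δ : List Ty} {σ : Ty} (ρ : Renaming Γ Δ) : Renaming Γ (σ :: Δ) :=
  fun τ i => .succ (ρ τ i)

/-- The extension of a renaming to the scope of a quantifier. -/
def Renaming.lift {Γ Δ : List Ty} {σ : Ty} (ρ : Renaming Γ Δ) : Renaming (σ :: Γ) (σ :: Δ)
  | _, .zero => .zero
  | τ, .succ i => .succ (ρ τ i)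

/-- The assignment to `Γ` induced by an assignment to `Δ` along a renaming. -/
def Env.comap {M : Interp.{u}} {Γ Δ : List Ty} (ρ : Renaming Γ Δ) (v : Env M Δ) : Env M Γ :=
  fun τ i => v τ (ρ τ i)

theorem Env.eq_nil {M : Interp.{u}} (v : Env M []) : v = Env.nil M := by
  funext τ i
  cases i

theorem Env.comap_lift_cons {M : Interp.{u}} {Γ Δ : List Ty} {σ : Ty} (ρ : Renaming Γ Δ)
    (v : Env M Δ) (x : M.Obj σ) : (v.cons x).comap ρ.lift = (v.comap ρ).cons x := by
  funext τ i
  cases i <;> rfl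

/-- A formula of the original language saying that the variable `y` is the value of a term whose
variables are renamed by `ρ`. -/
def FunTerm.graphFormula : {Γ Δ : List Ty} → {τ : Ty} → FunTerm Γ τ → Renaming Γ Δ → Var Δ τ →
    Formula Δ
  | _, _, _, .var i, ρ, y => .eq (.var y) (.var (ρ _ i))
  | _, _, _, .const c, _, y => .eq (.var y) (.const c)
  | _, _, _, .pair (σ := σ) (τ := τ) s t, ρ, y => .ex σ (.ex τ (.and
      (s.graphFormula ρ.weaken.weaken (.succ .zero)) (.and (t.graphFormula ρ.weaken.weaken .zero)
        (.eq (.var (.succ (.succ y))) (.pair (.var (.succ .zero)) (.var .zero))))))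
  | _, _, _, .app (σ := σ) (τ := τ) f t, ρ, y => .ex σ (.and (t.graphFormula ρ.weaken .zero)
      (.mem (.pair (.var .zero) (.var (.succ y)))
        (.const (τ := .set (.prod σ τ)) {p | p.2 = f p.1})))

theorem FunTerm.holds_graphFormula {M : FunInterp.{u}} {Γ Δ : List Ty} {τ : Ty} (t : FunTerm Γ τ)
    (ρ : Renaming Γ Δ) (y : Var Δ τ) (v : Env M.toInterp Δ) :
    (t.graphFormula ρ y).Holds M.toInterp v ↔ v τ y = t.eval (v.comap ρ) := by
  induction t generalizing Δ with
  | var i => simp only [graphFormula, Formula.Holds]; rfl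
  | const c => simp only [graphFormula, Formula.Holds]; rfl
  | pair s t hs ht =>
    simp only [graphFormula, Formula.Holds, hs, ht]
    exact ⟨fun ⟨_, _, hx, hx', h⟩ => h.trans (congrArg₂ M.pair hx hx'),
      fun h => ⟨_, _, rfl, rfl, h⟩⟩
  | app f t ht =>
    simp only [graphFormula, Formula.Holds, ht]
    exact ⟨fun ⟨_, hx, h⟩ => ((M.eq_app_iff f _ _).2 h).trans (congrArg (M.app f) hx),
      fun h => ⟨_, rfl, (M.eq_app_iff f _ _).1 h⟩⟩

/-- The elimination of function symbols, combined with a renaming of the free variables. -/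
def FunFormula.toFormula : {Γ Δ : List Ty} → FunFormula Γ → Renaming Γ Δ → Formula Δ
  | _, _, .eq (τ := τ) s t, ρ => .ex τ (.and (s.graphFormula ρ.weaken .zero)
      (t.graphFormula ρ.weaken .zero))
  | _, _, .mem (τ := τ) s t, ρ => .ex τ (.ex (.set τ) (.and
      (s.graphFormula ρ.weaken.weaken (.succ .zero)) (.and (t.graphFormula ρ.weaken.weaken .zero)
        (.mem (.var (.succ .zero)) (.var .zero)))))
  | _, _, .neg φ, ρ => .neg (φ.toFormula ρ)
  | _, _, .and φ ψ, ρ => .and (φ.toFormula ρ) (ψ.toFormula ρ)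
  | _, _, .or φ ψ, ρ => .or (φ.toFormula ρ) (ψ.toFormula ρ)
  | _, _, .imp φ ψ, ρ => .imp (φ.toFormula ρ) (ψ.toFormula ρ)
  | _, _, .iff φ ψ, ρ => .and (.imp (φ.toFormula ρ) (ψ.toFormula ρ))
      (.imp (ψ.toFormula ρ) (φ.toFormula ρ))
  | _, _, .all τ φ, ρ => .all τ (φ.toFormula ρ.lift)
  | _, _, .ex τ φ, ρ => .ex τ (φ.toFormula ρ.lift)

theorem FunFormula.holds_toFormula {M : FunInterp.{u}} {Γ Δ : List Ty} (φ : FunFormula Γ)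
    (ρ : Renaming Γ Δ) (v : Env M.toInterp Δ) :
    (φ.toFormula ρ).Holds M.toInterp v ↔ φ.Holds M (v.comap ρ) := by
  induction φ generalizing Δ with
  | eq s t =>
    simp only [toFormula, Formula.Holds, FunTerm.holds_graphFormula]
    exact ⟨fun ⟨_, h, h'⟩ => h.symm.trans h', fun h => ⟨_, rfl, h⟩⟩
  | mem s t =>
    simp only [toFormula, Formula.Holds, FunTerm.holds_graphFormula]
    exact ⟨fun ⟨_, _, hx, hA, h⟩ => (congrArg₂ M.mem hx hA).mp h, fun h => ⟨_, _, rfl, rfl, h⟩⟩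
  | neg φ h => simp only [toFormula, Formula.Holds, Holds, h]
  | and φ ψ h h' => simp only [toFormula, Formula.Holds, Holds, h, h']
  | or φ ψ h h' => simp only [toFormula, Formula.Holds, Holds, h, h']
  | imp φ ψ h h' => simp only [toFormula, Formula.Holds, Holds, h, h']
  | iff φ ψ h h' => simp only [toFormula, Formula.Holds, Holds, h, h', iff_iff_implies_and_implies]
  | all τ φ h => simp only [toFormula, Formula.Holds, Holds, h, Env.comap_lift_cons]
  | ex τ φ h => simp only [toFormula, Formula.Holds, Holds, h, Env.comap_lift_cons]

theorem FunFormula.holds_toFormula_weaken_lift {M : FunInterp.{u}} {Γ : List Ty} {σ τ : Ty}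
    (φ : FunFormula (σ :: Γ)) (y : M.Obj τ) (v : Env M.toInterp Γ) (x : M.Obj σ) :
    (φ.toFormula (Renaming.weaken fun _ i => i).lift).Holds M.toInterp ((v.cons y).cons x) ↔
      φ.Holds M (v.cons x) := by
  rw [holds_toFormula, Env.comap_lift_cons]
  rfl

/-- The standard interpretation of the expanded language. -/
def standardFun : FunInterp.{0} where
  toInterp := standard
  app f := f
  eq_app_iff _ _ _ := Iff.rfl

namespace FunTerm

variable {Γ : List Ty} {a b c d e : Ty}

/-- The variable with de Bruijn index 0. -/
abbrev v0 : FunTerm (a :: Γ) a := .var .zero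
/-- The variable with de Bruijn index 1. -/
abbrev v1 : FunTerm (a :: b :: Γ) b := .var (.succ .zero)
/-- The variable with de Bruijn index 2. -/
abbrev v2 : FunTerm (a :: b :: c :: Γ) c := .var (.succ (.succ .zero))
/-- The variable with de Bruijn index 3. -/
abbrev v3 : FunTerm (a :: b :: c :: d :: Γ) d := .var (.succ (.succ (.succ .zero)))
/-- The variable with de Bruijn index 4. -/
abbrev v4 : FunTerm (a :: b :: c :: d :: e :: Γ) e :=
  .var (.succ (.succ (.succ (.succ .zero))))

/-- The first component of a pair. -/
abbrev fst (t : FunTerm Γ (.prod a b)) : FunTerm Γ a :=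
  .app (σ := .prod a b) (fun p : a.Std × b.Std => p.1) t

/-- The second component of a pair. -/
abbrev snd (t : FunTerm Γ (.prod a b)) : FunTerm Γ b :=
  .app (σ := .prod a b) (fun p : a.Std × b.Std => p.2) t

/-- The sum of two hyperintegers. -/
abbrev add (s t : FunTerm Γ .nat) : FunTerm Γ .nat :=
  .app (σ := .prod .nat .nat) (τ := .nat) (fun p : ℕ × ℕ => p.1 + p.2) (.pair s t)

/-- The distance of two hyperintegers. -/
abbrev dist (s t : FunTerm Γ .nat) : FunTerm Γ .nat :=
  .app (σ := .prod .nat .nat) (τ := .nat) (fun p : ℕ × ℕ => (p.1 - p.2) + (p.2 - p.1)) (.pair s t)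

end FunTerm

namespace FunFormula

/-- The strict order of hyperintegers. -/
abbrev lt {Γ : List Ty} (s t : FunTerm Γ .nat) : FunFormula Γ :=
  .mem (.pair s t) (.const (τ := .set (.prod .nat .nat)) {p : ℕ × ℕ | p.1 < p.2})

/-- The weak order of hyperintegers. -/
abbrev le {Γ : List Ty} (s t : FunTerm Γ .nat) : FunFormula Γ := .neg (lt t s)

end FunFormula

namespace Universe

/-! ## Transfer and internal sets -/

/-- A nonstandard universe interprets function symbols by star-extensions of functions. -/
noncomputable def toFunInterp (U : Universe.{u}) : FunInterp.{u} where
  toInterp := U.toInterp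
  app := U.app
  eq_app_iff f x _ :=
    ⟨fun h => h ▸ U.app_spec f x, fun h => U.app_unique f x _ _ h (U.app_spec f x)⟩

variable (U : Universe.{u})

theorem transfer_of_forall_env : ∀ {Γ : List Ty} (φ : Formula Γ),
    (∀ v, φ.Holds standard v) → ∀ v, φ.Holds U.toInterp v
  | [], φ, h, v => by
    rw [Env.eq_nil v]
    exact (U.transfer φ).1 (h _)
  | τ :: Γ, φ, h, v => by
    have hv : v = Env.cons (v τ .zero) (fun σ i => v σ (.succ i)) := by
      funext σ i
      cases i <;> rfl
    rw [hv]
    exact transfer_of_forall_env (.all τ φ) (fun w x => h (w.cons x)) _ _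

theorem transfer_fun (φ : FunFormula []) (h : φ.Holds standardFun (Env.nil _)) :
    φ.Holds U.toFunInterp (Env.nil _) := by
  rw [← Env.eq_nil ((Env.nil _).comap fun _ i => i), ← FunFormula.holds_toFormula] at h ⊢
  exact (U.transfer _).1 h

/-- Internal comprehension, with the parameters given by the assignment `v`. -/
theorem isInternal_setOf_holds {Γ : List Ty} {σ : Ty} (φ : FunFormula (σ :: Γ))
    (v : Env U.toInterp Γ) :
    U.IsInternal {x : U.Obj σ | φ.Holds U.toFunInterp (Env.cons (M := U.toInterp) x v)} := by
  let ψ : Formula (σ :: .set σ :: Γ) := φ.toFormula (Renaming.weaken fun _ i => i).lift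
  obtain ⟨A, hA⟩ := U.transfer_of_forall_env (.ex (.set σ) (.all σ (.and
    (.imp (.mem (.var .zero) (.var (.succ .zero))) ψ)
    (.imp ψ (.mem (.var .zero) (.var (.succ .zero))))))) (fun v =>
      ⟨{x : σ.Std | φ.Holds standardFun (Env.cons (M := standard) x v)}, fun x =>
        ⟨(φ.holds_toFormula_weaken_lift (M := standardFun) _ v x).2,
          (φ.holds_toFormula_weaken_lift (M := standardFun) _ v x).1⟩⟩) v
  have hφ (x : U.Obj σ) := φ.holds_toFormula_weaken_lift (M := U.toFunInterp) A v x
  exact ⟨A, Set.ext fun x => ⟨fun hx => (hA x).2 ((hφ x).2 hx), fun hx => (hφ x).1 ((hA x).1 hx)⟩⟩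

variable {σ τ : Ty}

/-! ## Pairs and internal sets -/

/-- The first component of a pair. -/
noncomputable def fst (z : U.Obj (.prod σ τ)) : U.Obj σ :=
  U.app (σ := .prod σ τ) (fun p : σ.Std × τ.Std => p.1) z

/-- The second component of a pair. -/
noncomputable def snd (z : U.Obj (.prod σ τ)) : U.Obj τ :=
  U.app (σ := .prod σ τ) (fun p : σ.Std × τ.Std => p.2) z

@[simp]
theorem fst_pair (x : U.Obj σ) (y : U.Obj τ) : U.fst (U.pair x y) = x :=
  U.transfer_fun (.all σ (.all τ (.eq (.fst (.pair .v1 .v0)) .v1))) (fun _ _ => rfl) x y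

@[simp]
theorem snd_pair (x : U.Obj σ) (y : U.Obj τ) : U.snd (U.pair x y) = y :=
  U.transfer_fun (.all σ (.all τ (.eq (.snd (.pair .v1 .v0)) .v0))) (fun _ _ => rfl) x y

@[simp]
theorem pair_fst_snd (z : U.Obj (.prod σ τ)) : U.pair (U.fst z) (U.snd z) = z :=
  U.transfer_fun (.all (.prod σ τ) (.eq (.pair (.fst .v0) (.snd .v0)) .v0)) (fun _ => rfl) z

/-- The set of elements of an object of the type of sets. -/
def extent (A : U.Obj (.set τ)) : Set (U.Obj τ) := {x | U.mem x A}

variable {U}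

theorem isInternal_univ : U.IsInternal (Set.univ : Set (U.Obj τ)) := by
  have huniv : (Set.univ : Set (U.Obj τ)) = {x | x = x} := by simp
  exact huniv ▸ U.isInternal_setOf_holds (σ := τ) (.eq .v0 .v0) (Env.nil _)

namespace IsInternal

theorem compl {s : Set (U.Obj τ)} (hs : U.IsInternal s) : U.IsInternal sᶜ := by
  obtain ⟨A, rfl⟩ := hs
  exact U.isInternal_setOf_holds (σ := τ) (.neg (.mem .v0 .v1)) ((Env.nil _).cons A)

theorem inter {s t : Set (U.Obj τ)} (hs : U.IsInternal s) (ht : U.IsInternal t) :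
    U.IsInternal (s ∩ t) := by
  obtain ⟨A, rfl⟩ := hs
  obtain ⟨B, rfl⟩ := ht
  exact U.isInternal_setOf_holds (σ := τ) (.and (.mem .v0 .v1) (.mem .v0 .v2))
    (((Env.nil _).cons B).cons A)

theorem preimage_app {s : Set (U.Obj τ)} (hs : U.IsInternal s) (f : σ.Std → τ.Std) :
    U.IsInternal (U.app f ⁻¹' s) := by
  obtain ⟨A, rfl⟩ := hs
  exact U.isInternal_setOf_holds (σ := σ) (.mem (.app f .v0) .v1) ((Env.nil _).cons A)

theorem image_fst {s : Set (U.Obj (.prod σ τ))} (hs : U.IsInternal s) :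
    U.IsInternal (U.fst '' s) := by
  obtain ⟨A, rfl⟩ := hs
  exact U.isInternal_setOf_holds (σ := σ)
    (.ex (.prod σ τ) (.and (.mem .v0 .v2) (.eq (.fst .v0) .v1))) ((Env.nil _).cons A)

theorem biInter_finset {ι : Type*} {A : ι → Set (U.Obj τ)} (hA : ∀ i, U.IsInternal (A i))
    (F : Finset ι) : U.IsInternal (⋂ i ∈ F, A i) := by
  classical
  induction F using Finset.induction_on with
  | empty => simpa using isInternal_univ
  | insert i F _ ih => simpa using (hA i).inter ih

end IsInternal

/-! ## Saturation -/

theorem exists_forall_mem {A : ℕ → Set (U.Obj τ)} (hA : ∀ n, U.IsInternal (A n))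
    (h : ∀ n, ∃ x, ∀ i ≤ n, x ∈ A i) : ∃ x, ∀ i, x ∈ A i := by
  choose B hB using hA
  simp only [hB] at h ⊢
  exact U.saturated τ B h

theorem exists_forall_mem_of_antitone {A : ℕ → Set (U.Obj τ)} (hA : ∀ n, U.IsInternal (A n))
    (hanti : Antitone A) (hne : ∀ n, (A n).Nonempty) : ∃ x, ∀ i, x ∈ A i :=
  exists_forall_mem hA fun n => (hne n).imp fun _ hx _ hi => hanti hi hx

theorem IsInternal.exists_subset_biUnion {s : Set (U.Obj τ)} (hs : U.IsInternal s)
    {A : ℕ → Set (U.Obj τ)} (hA : ∀ n, U.IsInternal (A n)) (hsub : s ⊆ ⋃ n, A n) :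
    ∃ k, s ⊆ ⋃ i ≤ k, A i := by
  by_contra! h
  obtain ⟨x, hx⟩ := exists_forall_mem (fun n => hs.inter (hA n).compl) fun n => by
    obtain ⟨x, hxs, hx⟩ := Set.not_subset.1 (h n)
    exact ⟨x, fun i hi => ⟨hxs, fun hxi => hx (Set.mem_biUnion hi hxi)⟩⟩
  obtain ⟨i, hi⟩ := Set.mem_iUnion.1 (hsub (hx 0).1)
  exact (hx i).2 hi

theorem exists_forall_notMem {I : Set (Set (U.Obj τ))} (hne : I.Nonempty)
    (hI : ∀ s ∈ I, U.IsInternal s ∧ s.Nonempty) (W : ℕ → Set (U.Obj τ))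
    (hW : ∀ i, ∀ s ∈ I, ∃ t ∈ I, t ⊆ s \ W i) : ∃ x, ∀ i, x ∉ W i := by
  choose next next_mem next_sub using hW
  obtain ⟨s₀, hs₀⟩ := hne
  let A : ℕ → I := fun n => n.rec ⟨s₀, hs₀⟩ fun i s => ⟨next i s s.2, next_mem i s s.2⟩
  have hsucc (n : ℕ) : (A (n + 1)).1 ⊆ (A n).1 \ W n := next_sub n _ (A n).2
  obtain ⟨x, hx⟩ := exists_forall_mem_of_antitone (fun n => (hI _ (A n).2).1)
    (antitone_nat_of_succ_le fun n => (hsucc n).trans Set.sdiff_subset) fun n => (hI _ (A n).2).2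
  exact ⟨x, fun i => (hsucc i (hx (i + 1))).2⟩

variable (U)

/-! ## The ordered monoid of hyperintegers -/

noncomputable instance : LinearOrder U.HNat where
  lt := U.lt
  le x y := ¬ U.lt y x
  le_refl := U.transfer_fun (.all .nat (.le .v0 .v0)) (fun x : ℕ => lt_irrefl x)
  le_trans := U.transfer_fun (.all .nat (.all .nat (.all .nat
    (.imp (.le .v2 .v1) (.imp (.le .v1 .v0) (.le .v2 .v0))))))
    (show ∀ x y z : ℕ, ¬ y < x → ¬ z < y → ¬ z < x by omega)
  lt_iff_le_not_ge := U.transfer_fun (.all .nat (.all .nat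
    (.iff (.lt .v1 .v0) (.and (.le .v1 .v0) (.neg (.le .v0 .v1))))))
    (show ∀ x y : ℕ, x < y ↔ ¬ y < x ∧ ¬ ¬ x < y by omega)
  le_antisymm := U.transfer_fun (.all .nat (.all .nat
    (.imp (.le .v1 .v0) (.imp (.le .v0 .v1) (.eq .v1 .v0)))))
    (show ∀ x y : ℕ, ¬ y < x → ¬ x < y → x = y by omega)
  le_total := U.transfer_fun (.all .nat (.all .nat (.or (.le .v1 .v0) (.le .v0 .v1))))
    (show ∀ x y : ℕ, ¬ y < x ∨ ¬ x < y by omega)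
  toDecidableLE := Classical.decRel _

noncomputable instance : Add U.HNat := ⟨U.add⟩

noncomputable instance : Zero U.HNat := ⟨U.star (τ := .nat) (0 : ℕ)⟩

noncomputable instance : AddCommMonoid U.HNat where
  add_assoc := U.transfer_fun (.all .nat (.all .nat (.all .nat
    (.eq (.add (.add .v2 .v1) .v0) (.add .v2 (.add .v1 .v0)))))) (fun x y z : ℕ => add_assoc x y z)
  add_comm := U.transfer_fun (.all .nat (.all .nat (.eq (.add .v1 .v0) (.add .v0 .v1))))
    (fun x y : ℕ => add_comm x y)
  zero_add := U.transfer_fun (.all .nat (.eq (.add (.const (τ := .nat) (0 : ℕ)) .v0) .v0))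
    (fun x : ℕ => zero_add x)
  add_zero := U.transfer_fun (.all .nat (.eq (.add .v0 (.const (τ := .nat) (0 : ℕ))) .v0))
    (fun x : ℕ => add_zero x)
  nsmul := nsmulRec

noncomputable instance : One U.HNat := ⟨U.star (τ := .nat) (1 : ℕ)⟩

instance : IsOrderedCancelAddMonoid U.HNat :=
  IsOrderedCancelAddMonoid.of_add_lt_add_left <| U.transfer_fun (.all .nat (.all .nat (.all .nat
    (.imp (.lt .v1 .v0) (.lt (.add .v2 .v1) (.add .v2 .v0))))))
    (show ∀ z x y : ℕ, x < y → z + x < z + y by omega)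

instance : CanonicallyOrderedAdd U.HNat where
  exists_add_of_le {x y} := U.transfer_fun (.all .nat (.all .nat (.imp (.le .v1 .v0)
    (.ex .nat (.eq .v1 (.add .v2 .v0))))))
    (show ∀ x y : ℕ, ¬ y < x → ∃ z, y = x + z from fun x y h => ⟨y - x, by omega⟩) x y
  le_add_self := U.transfer_fun (.all .nat (.all .nat (.le .v1 (.add .v0 .v1))))
    (show ∀ x y : ℕ, ¬ y + x < x by omega)
  le_self_add := U.transfer_fun (.all .nat (.all .nat (.le .v1 (.add .v1 .v0))))
    (show ∀ x y : ℕ, ¬ x + y < x by omega)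

theorem dist_lt_iff {x y l : U.HNat} : U.dist x y < l ↔ x < y + l ∧ y < x + l :=
  U.transfer_fun (.all .nat (.all .nat (.all .nat (.iff (.lt (.dist .v2 .v1) .v0)
    (.and (.lt .v2 (.add .v1 .v0)) (.lt .v1 (.add .v2 .v0)))))))
    (show ∀ x y l : ℕ, x - y + (y - x) < l ↔ x < y + l ∧ y < x + l by omega) x y l

/-! ## Intervals and hyperfinite sets -/

theorem isInternal_Ico (x y : U.HNat) : U.IsInternal (Set.Ico x y) :=
  U.isInternal_setOf_holds (σ := .nat) (.and (.le .v1 .v0) (.lt .v0 .v2))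
    (((Env.nil _).cons y).cons x)

theorem isInternal_hyperfinite : U.IsInternal U.hyperfinite := ⟨_, rfl⟩

theorem exists_hyperfinite_extent_eq {F : Set U.HNat} (hF : F.Finite) :
    ∃ S ∈ U.hyperfinite, U.extent S = F := by
  induction F, hF using Set.Finite.induction_on with
  | empty =>
    refine ⟨U.star (τ := .set .nat) (∅ : Set ℕ), U.transfer_fun (.mem
      (.const (τ := .set .nat) (∅ : Set ℕ)) (.const (τ := .set (.set .nat)) {s : Set ℕ | s.Finite}))
      Set.finite_empty, Set.eq_empty_of_forall_notMem ?_⟩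
    exact U.transfer_fun (.all .nat (.neg (.mem .v0 (.const (τ := .set .nat) (∅ : Set ℕ)))))
      fun x : ℕ => Set.notMem_empty x
  | @insert x F _ _ ih =>
    obtain ⟨S, hS, rfl⟩ := ih
    obtain ⟨T, hT, hmem⟩ := U.transfer_fun (.all (.set .nat) (.all .nat (.imp
      (.mem .v1 (.const (τ := .set (.set .nat)) {s : Set ℕ | s.Finite})) (.ex (.set .nat) (.and
        (.mem .v0 (.const (τ := .set (.set .nat)) {s : Set ℕ | s.Finite}))
        (.all .nat (.iff (.mem .v0 .v1) (.or (.eq .v0 .v2) (.mem .v0 .v3)))))))))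
      (fun (s : Set ℕ) (x : ℕ) hs =>
        ⟨(insert x s : Set ℕ), Set.Finite.insert x hs, fun _ => Iff.rfl⟩) S x hS
    exact ⟨T, hT, Set.ext hmem⟩

theorem exists_hyperfinite_initial_segments {v : ℕ → U.HNat} (hv : StrictMono v) :
    ∃ S ∈ U.hyperfinite, ∀ i, U.extent S ∩ Set.Iio (v i) = v '' Set.Iio i := by
  choose F hF hFv using fun i => U.exists_hyperfinite_extent_eq ((Set.finite_Iio i).image v)
  have hint (i : ℕ) : U.IsInternal {S | U.extent S ∩ Set.Iio (v i) = U.extent (F i)} := by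
    simp only [Set.ext_iff]
    exact U.isInternal_setOf_holds (σ := .set .nat)
      (.all .nat (.iff (.and (.mem .v0 .v1) (.lt .v0 .v2)) (.mem .v0 .v3)))
      (((Env.nil _).cons (F i)).cons (v i))
  obtain ⟨S, hS⟩ := exists_forall_mem (fun i => U.isInternal_hyperfinite.inter (hint i)) fun n => by
    refine ⟨F n, fun i hi => ⟨hF n, ?_⟩⟩
    change U.extent (F n) ∩ _ = _
    have hpre : v ⁻¹' Set.Iio (v i) = Set.Iio i := Set.ext fun _ => hv.lt_iff_lt
    rw [hFv, hFv, ← Set.image_inter_preimage, hpre, Set.Iio_inter_Iio, min_eq_right hi]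
  exact ⟨S, (hS 0).1, fun i => (hS i).2.trans (hFv i)⟩

end Universe

/-! ## Countably determined sets -/

/-- A set determined by a sequence of sets: membership of a point in `s` only depends on which of
the sets `X m` the point belongs to. -/
def DeterminedBy {α : Type*} (X : ℕ → Set α) (s : Set α) : Prop :=
  ∀ ⦃z w⦄, (∀ m, z ∈ X m ↔ w ∈ X m) → z ∈ s → w ∈ s

/-- The points that belong to the same sets among `X 0, …, X (k - 1)` as `z` does. -/
def cell {α : Type*} (X : ℕ → Set α) (k : ℕ) (z : α) : Set α :=
  {w | ∀ i < k, z ∈ X i ↔ w ∈ X i}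

theorem cell_antitone {α : Type*} (X : ℕ → Set α) (z : α) : Antitone (cell X · z) :=
  fun _ _ hkl _ hw i hi => hw i (hi.trans_le hkl)

theorem mem_cell_self {α : Type*} (X : ℕ → Set α) (k : ℕ) (z : α) : z ∈ cell X k z :=
  fun _ _ => Iff.rfl

theorem countable_range_cell {α : Type*} (X : ℕ → Set α) (k : ℕ) :
    (Set.range (cell X k)).Countable := by
  classical
  refine (Set.countable_range fun b : Finset ℕ => {w | ∀ i < k, i ∈ b ↔ w ∈ X i}).mono ?_
  rintro _ ⟨z, rfl⟩
  refine ⟨(Finset.range k).filter (z ∈ X ·), Set.ext fun w => forall₂_congr fun i hi => ?_⟩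
  simp [hi]

namespace Universe

variable {U : Universe.{u}} {σ τ : Ty}

theorem IsInternal.cell {X : ℕ → Set (U.Obj τ)} (hX : ∀ m, U.IsInternal (X m)) (k : ℕ)
    (z : U.Obj τ) : U.IsInternal (cell X k z) := by
  classical
  have h : NSA.cell X k z = ⋂ i ∈ Finset.range k, if z ∈ X i then X i else (X i)ᶜ := by
    ext w
    simp only [NSA.cell, Set.mem_ofPred_eq, Set.mem_iInter, Finset.mem_range]
    refine forall₂_congr fun i _ => ?_
    split_ifs with hz <;> simp [hz]
  rw [h]
  refine IsInternal.biInter_finset (fun i => ?_) _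
  split_ifs
  exacts [hX i, (hX i).compl]

theorem isCD_iff {s : Set (U.Obj τ)} :
    U.IsCD s ↔ ∃ X : ℕ → Set (U.Obj τ), (∀ m, U.IsInternal (X m)) ∧ DeterminedBy X s := by
  constructor
  · rintro ⟨X, B, hX, rfl⟩
    refine ⟨X, hX, fun z w hzw hz => ?_⟩
    simpa only [Set.mem_iUnion, Set.mem_inter_iff, Set.mem_iInter, Set.mem_sdiff, hzw] using hz
  · rintro ⟨X, hX, hs⟩
    -- Prefixing the whole space makes `⋃ n, X n` disappear from the definition.
    let Y : ℕ → Set (U.Obj τ) := fun m => m.casesOn Set.univ X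
    have hY (z : U.Obj τ) : z ∈ ⋃ m, Y m := Set.mem_iUnion.2 ⟨0, trivial⟩
    refine ⟨Y, (fun z => {m | z ∈ Y m}) '' s, fun m => ?_, Set.ext fun w => ?_⟩
    · cases m
      exacts [isInternal_univ, hX _]
    · simp only [Set.mem_iUnion, Set.mem_inter_iff, Set.mem_iInter, Set.mem_sdiff, hY,
        true_and]
      constructor
      · exact fun hw => ⟨_, ⟨w, hw, rfl⟩, fun _ => id, fun _ => id⟩
      · rintro ⟨_, ⟨z, hz, rfl⟩, h, h'⟩
        exact hs (fun m => ⟨h (m + 1), not_imp_not.1 (h' (m + 1))⟩) hz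

theorem IsBorel.isCD {s : Set (U.Obj τ)} (hs : U.IsBorel s) : U.IsCD s := by
  rw [isCD_iff]
  induction s, hs using MeasurableSpace.generateFrom_induction with
  | hC t ht _ => exact ⟨fun _ => t, fun _ => ht, fun z w h => (h 0).1⟩
  | empty => exact ⟨fun _ => Set.univ, fun _ => isInternal_univ, fun _ _ _ => id⟩
  | compl t _ ih =>
    obtain ⟨X, hX, ht⟩ := ih
    exact ⟨X, hX, fun z w h => mt (ht fun m => (h m).symm)⟩
  | iUnion t _ ih =>
    choose X hX ht using ih
    refine ⟨fun m => X m.unpair.1 m.unpair.2, fun m => hX _ _, fun z w h hz => ?_⟩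
    obtain ⟨n, hn⟩ := Set.mem_iUnion.1 hz
    exact Set.mem_iUnion.2 ⟨n, ht n (fun m => by simpa using h (Nat.pair n m)) hn⟩

theorem BorelLE.cdLE {E : U.RelOn σ} {F : U.RelOn τ} (h : BorelLE E F) : CDLE E F :=
  h.imp fun _ hθ => ⟨hθ.1.isCD, hθ.2⟩

theorem exists_cell_of_determinedBy {X : ℕ → Set (U.Obj τ)} {s : Set (U.Obj τ)}
    (hX : ∀ m, U.IsInternal (X m)) (hs : DeterminedBy X s) {R : ℕ → U.Obj τ → U.Obj τ → Prop}
    (hR : ∀ n, U.IsInternal {q : U.Obj (.prod τ τ) | R n (U.fst q) (U.snd q)}) (hanti : Antitone R)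
    (hsR : ∀ x ∈ s, ∀ y ∈ s, ∃ n, ¬ R n x y) {z : U.Obj τ} (hz : z ∈ s) :
    ∃ k, ∀ x ∈ cell X k z, ∀ y ∈ cell X k z, ¬ R k x y := by
  -- Otherwise, by saturation, some pair lies in every `R k` and in every cell around `z`.
  by_contra! h
  obtain ⟨q, hq⟩ := exists_forall_mem_of_antitone
    (fun k => (((IsInternal.cell hX k z).preimage_app _).inter
      ((IsInternal.cell hX k z).preimage_app _)).inter (hR k))
    (fun k l hkl q hq => ⟨⟨cell_antitone X z hkl hq.1.1, cell_antitone X z hkl hq.1.2⟩,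
      hanti hkl _ _ hq.2⟩)
    (fun k => by
      obtain ⟨x, hx, y, hy, hxy⟩ := h k
      refine ⟨U.pair x y, ⟨?_, ?_⟩, by simpa using hxy⟩
      exacts [(U.fst_pair x y).symm ▸ hx, (U.snd_pair x y).symm ▸ hy])
  have hmem {x : U.Obj τ} (hx : ∀ k, x ∈ cell X k z) : x ∈ s :=
    hs (fun m => hx (m + 1) m m.lt_succ_self) hz
  obtain ⟨n, hn⟩ := hsR _ (hmem fun k => (hq k).1.1) _ (hmem fun k => (hq k).1.2)
  exact hn (hq n).2

theorem IsCD.exists_internal_cover {s : Set (U.Obj τ)} (hs : U.IsCD s)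
    {R : ℕ → U.Obj τ → U.Obj τ → Prop}
    (hR : ∀ n, U.IsInternal {q : U.Obj (.prod τ τ) | R n (U.fst q) (U.snd q)}) (hanti : Antitone R)
    (hsR : ∀ x ∈ s, ∀ y ∈ s, ∃ n, ¬ R n x y) :
    ∃ A : ℕ → Set (U.Obj τ), (∀ i, U.IsInternal (A i)) ∧ s ⊆ ⋃ i, A i ∧
      ∀ i, ∃ n, ∀ x ∈ A i, ∀ y ∈ A i, ¬ R n x y := by
  obtain ⟨X, hX, hdet⟩ := isCD_iff.1 hs
  rcases s.eq_empty_or_nonempty with rfl | ⟨z₀, hz₀⟩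
  · exact ⟨fun _ => Set.univᶜ, fun _ => isInternal_univ.compl, Set.empty_subset _, by simp⟩
  let good : Set (Set (U.Obj τ)) :=
    {A | ∃ k, A ∈ Set.range (cell X k) ∧ ∀ x ∈ A, ∀ y ∈ A, ¬ R k x y}
  have hgood {z : U.Obj τ} (hz : z ∈ s) : ∃ k, cell X k z ∈ good :=
    (exists_cell_of_determinedBy hX hdet hR hanti hsR hz).imp fun k hk => ⟨k, ⟨z, rfl⟩, hk⟩
  have hcount : good.Countable :=
    (Set.countable_iUnion fun k => countable_range_cell X k).mono fun A ⟨k, hA, _⟩ =>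
      Set.mem_iUnion.2 ⟨k, hA⟩
  obtain ⟨k₀, hk₀⟩ := hgood hz₀
  obtain ⟨A, hA⟩ := hcount.exists_eq_range ⟨_, hk₀⟩
  have hAgood (i : ℕ) : A i ∈ good := hA ▸ Set.mem_range_self i
  refine ⟨A, fun i => ?_, fun z hz => ?_, fun i => ?_⟩
  · obtain ⟨k, ⟨z, hz⟩, _⟩ := hAgood i
    exact hz ▸ IsInternal.cell hX k z
  · obtain ⟨k, hk⟩ := hgood hz
    obtain ⟨i, hi⟩ := hA ▸ hk
    exact Set.mem_iUnion.2 ⟨i, hi ▸ mem_cell_self X k z⟩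
  · obtain ⟨k, _, hk⟩ := hAgood i
    exact ⟨k, hk⟩

end Universe

/-! ## Bounded cardinality -/

theorem succ_le_encard_iff {α : Type*} {s : Set α} {k : ℕ} :
    ((k + 1 : ℕ) : ℕ∞) ≤ s.encard ↔ ∃ x ∈ s, (k : ℕ∞) ≤ (s \ {x}).encard := by
  have hcard {x : α} (hx : x ∈ s) : ((k + 1 : ℕ) : ℕ∞) ≤ s.encard ↔ k ≤ (s \ {x}).encard := by
    rw [← Set.encard_sdiff_singleton_add_one hx, Nat.cast_succ,
      ENat.add_le_add_iff_right ENat.one_ne_top]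
  refine ⟨fun h => ?_, fun ⟨x, hx, h⟩ => (hcard hx).2 h⟩
  obtain ⟨x, hx⟩ := Set.encard_ne_zero.1 (ne_bot_of_le_ne_bot (by simp) h)
  exact ⟨x, hx, (hcard hx).1 h⟩

namespace Universe

variable {U : Universe.{u}} {τ : Ty}

theorem isInternal_setOf_le_encard (k : ℕ) :
    U.IsInternal {s : U.Obj (.set τ) | (k : ℕ∞) ≤ (U.extent s).encard} := by
  induction k with
  | zero => simpa using isInternal_univ
  | succ k ih =>
    obtain ⟨B, hB⟩ := ih
    let stdErase (p : Set τ.Std × τ.Std) : Set τ.Std := p.1 \ {p.2}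
    have happ (s : U.Obj (.set τ)) (x : U.Obj τ) :
        U.extent (U.app (σ := .prod (.set τ) τ) (τ := .set τ) stdErase (U.pair s x)) =
          U.extent s \ {x} :=
      Set.ext <| U.transfer_fun (.all (.set τ) (.all τ (.all τ (.iff
        (.mem .v0 (.app (σ := .prod (.set τ) τ) (τ := .set τ) stdErase (.pair .v2 .v1)))
        (.and (.mem .v0 .v2) (.neg (.eq .v0 .v1))))))) (fun _ _ _ => Iff.rfl) s x
    have hmem (s : U.Obj (.set τ)) : (k : ℕ∞) ≤ (U.extent s).encard ↔ U.mem s B :=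
      Set.ext_iff.1 hB s
    simp only [succ_le_encard_iff, ← happ, hmem]
    exact U.isInternal_setOf_holds (σ := .set τ) (.ex τ (.and (.mem .v0 .v1)
      (.mem (.app (σ := .prod (.set τ) τ) (τ := .set τ) stdErase (.pair .v1 .v0)) .v2)))
      ((Env.nil _).cons B)

/-- The number of elements in which two internal sets differ, counted externally: it is `⊤` whenever
it is not a standard number. -/
noncomputable def diffCard (S T : U.Obj (.set τ)) : ℕ∞ :=
  (symmDiff (U.extent S) (U.extent T)).encard

theorem FD_rel_iff {S T : U.Obj (.set .nat)} : U.FD.rel S T ↔ diffCard S T < ⊤ :=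
  Set.encard_lt_top_iff.symm

theorem isInternal_setOf_le_diffCard (k : ℕ) :
    U.IsInternal {p : U.Obj (.prod (.set τ) (.set τ)) | k ≤ diffCard (U.fst p) (U.snd p)} := by
  let stdSymmDiff (p : Set τ.Std × Set τ.Std) : Set τ.Std := symmDiff p.1 p.2
  have happ (p : U.Obj (.prod (.set τ) (.set τ))) :
      U.extent (U.app (σ := .prod (.set τ) (.set τ)) (τ := .set τ) stdSymmDiff p) =
        symmDiff (U.extent (U.fst p)) (U.extent (U.snd p)) :=
    Set.ext <| U.transfer_fun (.all (.prod (.set τ) (.set τ)) (.all τ (.iff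
      (.mem .v0 (.app (σ := .prod (.set τ) (.set τ)) (τ := .set τ) stdSymmDiff .v1))
      (.or (.and (.mem .v0 (.fst .v1)) (.neg (.mem .v0 (.snd .v1))))
        (.and (.mem .v0 (.snd .v1)) (.neg (.mem .v0 (.fst .v1)))))))) (fun _ _ => Iff.rfl) p
  simp only [diffCard, ← happ]
  exact (isInternal_setOf_le_encard k).preimage_app _

end Universe

/-! ## Dyadic levels -/

/-- The number of odd multiples of `2 ^ w` in `(0, x]`, tagged with `w`, for `p = (w, x)`. Odd
multiples are used because a number is an odd multiple of `2 ^ w` for at most one `w`, so that the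
passage from `x` to `x + 1` changes at most one level. -/
def dyadicLevel (p : ℕ × ℕ) : ℕ := Nat.pair p.1 ((p.2 + 2 ^ p.1) / 2 ^ (p.1 + 1))

theorem exists_odd_mul_two_pow_of_dyadicLevel_ne {x y w : ℕ} (hxy : x ≤ y)
    (h : dyadicLevel (w, x) ≠ dyadicLevel (w, y)) :
    ∃ m, Odd m ∧ x < m * 2 ^ w ∧ m * 2 ^ w ≤ y := by
  have hlt : (x + 2 ^ w) / 2 ^ (w + 1) < (y + 2 ^ w) / 2 ^ (w + 1) :=
    lt_of_le_of_ne (Nat.div_le_div_right (by omega)) fun he => h (congrArg (Nat.pair w) he)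
  set k := (x + 2 ^ w) / 2 ^ (w + 1) with hk
  have hx : x + 2 ^ w < (k + 1) * 2 ^ (w + 1) :=
    (Nat.div_lt_iff_lt_mul (by positivity)).1 (hk ▸ k.lt_succ_self)
  have hy : (k + 1) * 2 ^ (w + 1) ≤ y + 2 ^ w :=
    (Nat.mul_le_mul_right _ hlt).trans (Nat.div_mul_le_self _ _)
  have hm : (k + 1) * 2 ^ (w + 1) = (2 * k + 1) * 2 ^ w + 2 ^ w := by ring
  exact ⟨2 * k + 1, odd_two_mul_add_one k, by omega, by omega⟩

theorem le_of_odd_mul_two_pow_eq {m m' w w' : ℕ} (hm : Odd m) (h : m * 2 ^ w = m' * 2 ^ w') :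
    w' ≤ w := by
  by_contra! hlt
  obtain ⟨d, rfl⟩ := Nat.exists_eq_add_of_lt hlt
  have hm' : m = 2 * (m' * 2 ^ d) :=
    Nat.eq_of_mul_eq_mul_right (by positivity : 0 < 2 ^ w) (h.trans (by ring))
  exact Nat.not_even_iff_odd.2 hm (hm' ▸ even_two_mul _)

theorem eq_of_odd_mul_two_pow_mem_Ioc {v w w' m m' x y : ℕ} (hw : v ≤ w) (hw' : v ≤ w')
    (hm : Odd m) (hm' : Odd m') (hxy : y < x + 2 ^ v) (h : m * 2 ^ w ∈ Set.Ioc x y)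
    (h' : m' * 2 ^ w' ∈ Set.Ioc x y) : w = w' := by
  have hdvd {m w : ℕ} (hw : v ≤ w) : 2 ^ v ∣ m * 2 ^ w := (pow_dvd_pow 2 hw).mul_left m
  have he : m * 2 ^ w = m' * 2 ^ w' := by
    obtain ⟨⟨c, hc⟩, ⟨d, hd⟩⟩ := And.intro (hdvd (m := m) hw) (hdvd (m := m') hw')
    rw [hc] at h ⊢
    rw [hd] at h' ⊢
    rcases lt_trichotomy c d with hcd | rfl | hcd
    · nlinarith [h.1, h'.2]
    · rfl
    · nlinarith [h'.1, h.2]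
  exact le_antisymm (le_of_odd_mul_two_pow_eq hm' he.symm) (le_of_odd_mul_two_pow_eq hm he)

theorem exists_forall_dyadicLevel_ne {v x y : ℕ} (hxy : (x - y) + (y - x) < 2 ^ v) :
    ∃ w₀, ∀ w, dyadicLevel (w, x) ≠ dyadicLevel (w, y) → w < v ∨ w = w₀ := by
  wlog h : x ≤ y generalizing x y
  · obtain ⟨w₀, hw₀⟩ := this (x := y) (y := x) (by omega) (by omega)
    exact ⟨w₀, fun w hw => hw₀ w hw.symm⟩
  by_cases! hex : ∃ w, v ≤ w ∧ dyadicLevel (w, x) ≠ dyadicLevel (w, y)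
  · obtain ⟨w₀, hvw₀, hw₀⟩ := hex
    refine ⟨w₀, fun w hw => or_iff_not_imp_left.2 fun hvw => ?_⟩
    obtain ⟨m₀, hm₀, h₀⟩ := exists_odd_mul_two_pow_of_dyadicLevel_ne h hw₀
    obtain ⟨m, hm, h⟩ := exists_odd_mul_two_pow_of_dyadicLevel_ne h hw
    exact eq_of_odd_mul_two_pow_mem_Ioc (not_lt.1 hvw) hvw₀ hm hm₀ (by omega) h h₀
  · exact ⟨0, fun w hw => Or.inl (not_le.1 fun hvw => hw (hex w hvw))⟩

theorem dist_lt_of_dyadicLevel_eq {w x y : ℕ} (h : dyadicLevel (w, x) = dyadicLevel (w, y)) :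
    (x - y) + (y - x) < 2 ^ w + 2 ^ w := by
  have hdiv : (x + 2 ^ w) / 2 ^ (w + 1) = (y + 2 ^ w) / 2 ^ (w + 1) := (Nat.pair_eq_pair.1 h).2
  have hx := Nat.div_add_mod (x + 2 ^ w) (2 ^ (w + 1))
  have hy := Nat.div_add_mod (y + 2 ^ w) (2 ^ (w + 1))
  have hx' := Nat.mod_lt (x + 2 ^ w) (by positivity : 0 < 2 ^ (w + 1))
  have hy' := Nat.mod_lt (y + 2 ^ w) (by positivity : 0 < 2 ^ (w + 1))
  rw [← hdiv] at hy
  omega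

/-- The set of the levels of `x` with index in `s`, for `p = (s, x)`. -/
def dyadicCode (p : Set ℕ × ℕ) : Set ℕ := (fun w => dyadicLevel (w, p.2)) '' p.1

theorem two_pow_size_le {x y : ℕ} (h : x < y) : 2 ^ x.size ≤ y + y := by
  rcases x.eq_zero_or_pos with rfl | hx
  · simp only [Nat.size_zero, pow_zero]
    omega
  · have hsize : 2 ^ (x.size - 1) ≤ x := Nat.lt_size.1 (Nat.sub_lt (Nat.size_pos.2 hx) one_pos)
    have hpow : 2 ^ x.size = 2 * 2 ^ (x.size - 1) := by
      rw [← pow_succ', Nat.sub_add_cancel (Nat.size_pos.2 hx)]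
    omega

theorem finite_symmDiff_image_iff {α β : Type*} {f g : α → β} {s : Set α}
    (hf : Function.Injective f) (hfg : ∀ w w', f w = g w' → w = w') :
    (symmDiff (f '' s) (g '' s)).Finite ↔ {w ∈ s | f w ≠ g w}.Finite := by
  constructor
  · refine fun h => Set.Finite.of_finite_image (h.subset ?_) hf.injOn
    rintro _ ⟨w, ⟨hw, hne⟩, rfl⟩
    refine Or.inl ⟨⟨w, hw, rfl⟩, ?_⟩
    rintro ⟨w', -, h⟩
    obtain rfl := hfg w w' h.symm
    exact hne h.symm
  · refine fun h => ((h.image f).union (h.image g)).subset ?_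
    rintro _ (⟨⟨w, hw, rfl⟩, hne⟩ | ⟨⟨w, hw, rfl⟩, hne⟩)
    · exact Or.inl ⟨w, ⟨hw, fun he => hne ⟨w, hw, he.symm⟩⟩, rfl⟩
    · exact Or.inr ⟨w, ⟨hw, fun he => hne ⟨w, hw, he⟩⟩, rfl⟩

namespace FunTerm

variable {Γ : List Ty}

/-- The power of two with a given exponent. -/
abbrev twoPow (t : FunTerm Γ .nat) : FunTerm Γ .nat :=
  .app (σ := .nat) (τ := .nat) (fun n : ℕ => 2 ^ n) t

/-- The number of binary digits. -/
abbrev size (t : FunTerm Γ .nat) : FunTerm Γ .nat := .app (σ := .nat) (τ := .nat) Nat.size t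

/-- The star-extension of `dyadicLevel`. -/
abbrev level (s t : FunTerm Γ .nat) : FunTerm Γ .nat :=
  .app (σ := .prod .nat .nat) (τ := .nat) dyadicLevel (.pair s t)

/-- The star-extension of `dyadicCode`. -/
abbrev code (s : FunTerm Γ (.set .nat)) (t : FunTerm Γ .nat) : FunTerm Γ (.set .nat) :=
  .app (σ := .prod (.set .nat) .nat) (τ := .set .nat) dyadicCode (.pair s t)

end FunTerm

namespace Universe

variable {U : Universe.{u}}

/-- The hyperinteger power `2 ^ x`. -/
noncomputable def twoPow (x : U.HNat) : U.HNat :=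
  U.app (σ := .nat) (τ := .nat) (fun n : ℕ => 2 ^ n) x

/-- The number of binary digits of a hyperinteger. -/
noncomputable def size (x : U.HNat) : U.HNat := U.app (σ := .nat) (τ := .nat) Nat.size x

/-- The star-extension of `dyadicLevel`. -/
noncomputable def level (w x : U.HNat) : U.HNat :=
  U.app (σ := .prod .nat .nat) (τ := .nat) dyadicLevel (U.pair w x)

/-- The star-extension of `dyadicCode`: for an additive countably cofinal cut, and for a suitable
`S` that contains the exponents of cofinally many powers of two, this is the reduction to `FD`. -/
noncomputable def code (S : U.Obj (.set .nat)) (x : U.HNat) : U.Obj (.set .nat) :=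
  U.app (σ := .prod (.set .nat) .nat) (τ := .set .nat) dyadicCode (U.pair S x)

theorem lt_twoPow_size (x : U.HNat) : x < twoPow (size x) :=
  U.transfer_fun (.all .nat (.lt .v0 (.twoPow (.size .v0)))) Nat.lt_size_self x

theorem twoPow_size_le {x y : U.HNat} (h : x < y) : twoPow (size x) ≤ y + y :=
  U.transfer_fun (.all .nat (.all .nat (.imp (.lt .v1 .v0)
    (.le (.twoPow (.size .v1)) (.add .v0 .v0)))))
    (fun (_ _ : ℕ) h => not_lt.2 (two_pow_size_le h)) x y h

theorem twoPow_lt_twoPow_iff {x y : U.HNat} : twoPow x < twoPow y ↔ x < y :=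
  U.transfer_fun (.all .nat (.all .nat (.iff (.lt (.twoPow .v1) (.twoPow .v0)) (.lt .v1 .v0))))
    (fun _ _ : ℕ => Nat.pow_lt_pow_iff_right one_lt_two) x y

theorem eq_of_level_eq {w w' x y : U.HNat} (h : level w x = level w' y) : w = w' :=
  U.transfer_fun (.all .nat (.all .nat (.all .nat (.all .nat
    (.imp (.eq (.level .v3 .v1) (.level .v2 .v0)) (.eq .v3 .v2))))))
    (fun (_ _ _ _ : ℕ) h => (Nat.pair_eq_pair.1 h).1) w w' x y h

theorem exists_forall_level_ne {v x y : U.HNat} (hxy : U.dist x y < twoPow v) :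
    ∃ w₀, ∀ w, level w x ≠ level w y → w < v ∨ w = w₀ :=
  U.transfer_fun (.all .nat (.all .nat (.all .nat (.imp (.lt (.dist .v1 .v0) (.twoPow .v2))
    (.ex .nat (.all .nat (.imp (.neg (.eq (.level .v0 .v3) (.level .v0 .v2)))
      (.or (.lt .v0 .v4) (.eq .v0 .v1)))))))))
    (fun (_ _ _ : ℕ) h => exists_forall_dyadicLevel_ne h) v x y hxy

theorem dist_lt_of_level_eq {w x y : U.HNat} (h : level w x = level w y) :
    U.dist x y < twoPow w + twoPow w :=
  U.transfer_fun (.all .nat (.all .nat (.all .nat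
    (.imp (.eq (.level .v2 .v1) (.level .v2 .v0))
      (.lt (.dist .v1 .v0) (.add (.twoPow .v2) (.twoPow .v2)))))))
    (fun (_ _ _ : ℕ) h => dist_lt_of_dyadicLevel_eq h) w x y h

theorem extent_code (S : U.Obj (.set .nat)) (x : U.HNat) :
    U.extent (code S x) = (level · x) '' U.extent S :=
  Set.ext <| U.transfer_fun (.all (.set .nat) (.all .nat (.all .nat (.iff
    (.mem .v0 (.code .v2 .v1))
    (.ex .nat (.and (.mem .v0 .v3) (.eq (.level .v0 .v2) .v1)))))))
    (fun (_ : Set ℕ) (_ _ : ℕ) => Iff.rfl) S x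

theorem code_mem_hyperfinite {S : U.Obj (.set .nat)} (hS : S ∈ U.hyperfinite) (x : U.HNat) :
    code S x ∈ U.hyperfinite :=
  U.transfer_fun (.all (.set .nat) (.all .nat (.imp
    (.mem .v1 (.const (τ := .set (.set .nat)) {s : Set ℕ | s.Finite}))
    (.mem (.code .v1 .v0) (.const (τ := .set (.set .nat)) {s : Set ℕ | s.Finite})))))
    (fun (_ : Set ℕ) (_ : ℕ) hs => Set.Finite.image _ hs) S x hS

/-! ## Reduction of cofinal monadic relations to `FD` -/

theorem IsCountablyCofinalCut.isLowerSet {C : Set U.HNat} (hC : U.IsCountablyCofinalCut C) :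
    IsLowerSet C := by
  obtain ⟨a, -, rfl⟩ := hC
  exact fun _ _ hyx ⟨n, hn⟩ => ⟨n, lt_of_le_of_lt hyx hn⟩

theorem IsCountablyCofinalCut.exists_strictMono_twoPow {C : Set U.HNat}
    (hC : U.IsCountablyCofinalCut C) (hadd : U.IsAdditive C) :
    ∃ v : ℕ → U.HNat, StrictMono v ∧ (∀ n, twoPow (v n) ∈ C) ∧ ∀ x ∈ C, ∃ n, x < twoPow (v n) := by
  have hlower := hC.isLowerSet
  obtain ⟨a, ha, rfl⟩ := hC
  have hmono : StrictMono a := strictMono_nat_of_lt_succ ha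
  have hpow (n : ℕ) : ∃ m, twoPow (size (a n)) < a m :=
    hlower (twoPow_size_le (ha n)) (hadd _ ⟨_, ha (n + 1)⟩ _ ⟨_, ha (n + 1)⟩)
  choose m hm using hpow
  let next (n : ℕ) : ℕ := max (m n) (n + 1)
  have hnext (n : ℕ) : size (a n) < size (a (next n)) :=
    twoPow_lt_twoPow_iff.1 <| ((hm n).trans_le (hmono.monotone (le_max_left _ _))).trans
      (lt_twoPow_size _)
  have hiter (n : ℕ) : n ≤ next^[n] 0 := by
    induction n with
    | zero => exact Nat.zero_le _
    | succ n ih =>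
      rw [Function.iterate_succ_apply']
      exact (Nat.succ_le_succ ih).trans (le_max_right _ _)
  refine ⟨fun n => size (a (next^[n] 0)), strictMono_nat_of_lt_succ fun n => ?_, fun n => ⟨_, hm _⟩,
    fun x ⟨n, hn⟩ => ⟨n, ?_⟩⟩
  · rw [Function.iterate_succ_apply']
    exact hnext _
  · exact lt_of_lt_of_le (b := a n) hn ((hmono.monotone (hiter n)).trans (lt_twoPow_size _).le)

theorem finite_level_ne_iff {C : Set U.HNat} (hlower : IsLowerSet C) (hadd : U.IsAdditive C)
    {v : ℕ → U.HNat} (hv : StrictMono v) (hvC : ∀ n, twoPow (v n) ∈ C)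
    (hcof : ∀ x ∈ C, ∃ n, x < twoPow (v n)) {s : Set U.HNat}
    (hs : ∀ i, s ∩ Set.Iio (v i) = v '' Set.Iio i) (x y : U.HNat) :
    {w ∈ s | level w x ≠ level w y}.Finite ↔ U.dist x y ∈ C := by
  constructor
  · intro hfin
    by_contra hxy
    refine (Set.infinite_range_of_injective hv.injective) (hfin.subset ?_)
    rintro _ ⟨n, rfl⟩
    have hvs : v n ∈ s ∩ Set.Iio (v (n + 1)) := by
      rw [hs]
      exact Set.mem_image_of_mem v n.lt_succ_self
    exact ⟨hvs.1, fun he =>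
      hxy (hlower (dist_lt_of_level_eq he).le (hadd _ (hvC n) _ (hvC n)))⟩
  · intro hxy
    obtain ⟨n, hn⟩ := hcof _ hxy
    obtain ⟨w₀, hw₀⟩ := exists_forall_level_ne hn
    refine (((Set.finite_Iio n).image v).union (Set.finite_singleton w₀)).subset ?_
    rintro w ⟨hws, hne⟩
    exact (hw₀ w hne).imp (fun hlt => hs n ▸ ⟨hws, hlt⟩) id

theorem borelLE_monadic_FD {C : Set U.HNat} (hadd : U.IsAdditive C)
    (hC : U.IsCountablyCofinalCut C) : BorelLE (U.monadic C) U.FD := by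
  obtain ⟨v, hv, hvC, hcof⟩ := hC.exists_strictMono_twoPow hadd
  obtain ⟨S, hS, hSv⟩ := U.exists_hyperfinite_initial_segments hv
  let θ : (U.monadic C).dom → U.FD.dom := fun x => ⟨code S x, code_mem_hyperfinite hS x⟩
  have hgraph : graph θ = {z | U.snd z = code S (U.fst z)} := by
    refine Set.ext fun z => ⟨?_, fun hz => ⟨⟨U.fst z, trivial⟩, ?_⟩⟩
    · rintro ⟨x, rfl⟩
      simp only [Set.mem_ofPred_eq, snd_pair, fst_pair, θ]
    · simp only [θ, ← Set.mem_ofPred.1 hz, pair_fst_snd]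
  have hinternal : U.IsInternal (graph θ) := hgraph ▸
    U.isInternal_setOf_holds (σ := .prod .nat (.set .nat))
      (.eq (.snd .v0) (.code .v1 (.fst .v0))) ((Env.nil _).cons S)
  refine ⟨θ, MeasurableSpace.measurableSet_generateFrom hinternal, fun x y => ?_⟩
  · change U.dist x y ∈ C ↔ (symmDiff (U.extent (code S x)) (U.extent (code S y))).Finite
    rw [extent_code, extent_code, finite_symmDiff_image_iff (fun _ _ => eq_of_level_eq)
      (fun _ _ => eq_of_level_eq), finite_level_ne_iff hC.isLowerSet hadd hv hvC hcof hSv]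

variable {σ τ : Ty}

/-! ## Nonreducibility of coinitial monadic relations to `FD` -/

theorem IsInternal.prod_rel {R : U.Obj σ → U.Obj σ → Prop} {S : U.Obj τ → U.Obj τ → Prop}
    (hR : U.IsInternal {p : U.Obj (.prod σ σ) | R (U.fst p) (U.snd p)})
    (hS : U.IsInternal {p : U.Obj (.prod τ τ) | S (U.fst p) (U.snd p)}) :
    U.IsInternal {q : U.Obj (.prod (.prod σ τ) (.prod σ τ)) |
      R (U.fst (U.fst q)) (U.fst (U.snd q)) ∧ S (U.snd (U.fst q)) (U.snd (U.snd q))} := by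
  obtain ⟨A, hA⟩ := hR
  obtain ⟨B, hB⟩ := hS
  have hmemA (x y : U.Obj σ) : R x y ↔ U.mem (U.pair x y) A := by
    simpa using Set.ext_iff.1 hA (U.pair x y)
  have hmemB (x y : U.Obj τ) : S x y ↔ U.mem (U.pair x y) B := by
    simpa using Set.ext_iff.1 hB (U.pair x y)
  simp only [hmemA, hmemB]
  exact U.isInternal_setOf_holds (σ := .prod (.prod σ τ) (.prod σ τ))
    (.and (.mem (.pair (.fst (.fst .v0)) (.fst (.snd .v0))) .v1)
      (.mem (.pair (.snd (.fst .v0)) (.snd (.snd .v0))) .v2)) (((Env.nil _).cons B).cons A)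

theorem isInternal_setOf_dist_lt (l : U.HNat) :
    U.IsInternal {p : U.Obj (.prod .nat .nat) | U.dist (U.fst p) (U.snd p) < l} :=
  U.isInternal_setOf_holds (σ := .prod .nat .nat) (.lt (.dist (.fst .v0) (.snd .v0)) .v1)
    ((Env.nil _).cons l)

theorem exists_quarter (l : U.HNat) :
    ∃ h, h + h + (h + h) ≤ l ∧ l < (h + 1) + (h + 1) + ((h + 1) + (h + 1)) :=
  let one : FunTerm [.nat, .nat] .nat := .const (τ := .nat) (1 : ℕ)
  U.transfer_fun (.all .nat (.ex .nat (.and (.le (.add (.add .v0 .v0) (.add .v0 .v0)) .v1)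
    (.lt .v1 (.add (.add (.add .v0 one) (.add .v0 one)) (.add (.add .v0 one) (.add .v0 one)))))))
    (fun l : ℕ => ⟨l / 4, show ¬ l < l / 4 + l / 4 + (l / 4 + l / 4) ∧
      l < (l / 4 + 1) + (l / 4 + 1) + ((l / 4 + 1) + (l / 4 + 1)) by omega⟩) l

theorem add_one_le_of_lt {x y : U.HNat} (h : x < y) : x + 1 ≤ y :=
  U.transfer_fun (.all .nat (.all .nat (.imp (.lt .v1 .v0)
    (.le (.add .v1 (.const (τ := .nat) (1 : ℕ))) .v0))))
    (show ∀ x y : ℕ, x < y → ¬ y < x + 1 by omega) x y h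

theorem exists_Ico_subset_far {p l x : U.HNat} (hx : x ∈ Set.Ico p (p + l)) :
    ∃ q h, l < (h + 1) + (h + 1) + ((h + 1) + (h + 1)) ∧
      Set.Ico q (q + h) ⊆ Set.Ico p (p + l) ∩ {y | h ≤ U.dist x y} := by
  obtain ⟨h, hle, hlt⟩ := exists_quarter l
  -- Of the four quarters of the interval, the first or the last is at distance `h` from `x`.
  rcases lt_or_ge x (p + (h + h)) with hxh | hxh
  · refine ⟨p + (h + h + h), h, hlt, fun y hy => ⟨⟨?_, ?_⟩, ?_⟩⟩
    all_goals simp only [Set.mem_Ico, Set.mem_ofPred_eq, ← not_lt, dist_lt_iff] at *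
    all_goals have : 0 ≤ h := zero_le; grind
  · refine ⟨p, h, hlt, fun y hy => ⟨⟨?_, ?_⟩, ?_⟩⟩
    all_goals simp only [Set.mem_Ico, Set.mem_ofPred_eq, ← not_lt, dist_lt_iff] at *
    all_goals have : 0 ≤ h := zero_le; grind

theorem IsCountablyCoinitialCut.isLowerSet {C : Set U.HNat} (hC : U.IsCountablyCoinitialCut C) :
    IsLowerSet C := by
  obtain ⟨a, -, rfl⟩ := hC
  exact fun _ _ hyx hx n => lt_of_le_of_lt hyx (hx n)

theorem IsCountablyCoinitialCut.one_mem {C : Set U.HNat} (hC : U.IsCountablyCoinitialCut C) :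
    1 ∈ C := by
  obtain ⟨a, ha, rfl⟩ := hC
  intro n
  have hone : 0 + 1 ≤ a (n + 1) :=
    add_one_le_of_lt (lt_of_le_of_lt zero_le (ha (n + 1) : a (n + 2) < a (n + 1)))
  exact lt_of_le_of_lt (zero_add (1 : U.HNat) ▸ hone) (ha n)

theorem exists_forall_notMem_of_dist_mem {C : Set U.HNat} (hlower : IsLowerSet C)
    (hadd : U.IsAdditive C) (hone : 1 ∈ C) (hne : C ≠ Set.univ) {W : ℕ → Set U.HNat}
    (hW : ∀ i, ∃ l ∉ C, ∀ x ∈ W i, ∀ y ∈ W i, U.dist x y < l → U.dist x y ∈ C) :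
    ∃ x, ∀ i, x ∉ W i := by
  have hzero : (0 : U.HNat) ∈ C := hlower zero_le hone
  obtain ⟨l₀, hl₀⟩ := (Set.ne_univ_iff_exists_notMem C).1 hne
  refine exists_forall_notMem (I := {s | ∃ p, ∃ l ∉ C, s = Set.Ico p (p + l)})
    ⟨_, 0, l₀, hl₀, rfl⟩ ?_ W ?_
  · rintro _ ⟨p, l, hl, rfl⟩
    have hpos : 0 < l := lt_of_not_ge fun h => hl (hlower h hzero)
    exact ⟨isInternal_Ico U _ _, p, le_rfl, lt_add_of_pos_right p hpos⟩
  · rintro i _ ⟨p, l, hl, rfl⟩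
    obtain ⟨m, hm, hWm⟩ := hW i
    have hlm : min l m ∉ C := by
      rcases min_choice l m with h | h <;> rwa [h]
    have hsub : Set.Ico p (p + min l m) ⊆ Set.Ico p (p + l) :=
      Set.Ico_subset_Ico_right (add_le_add_right (min_le_left l m) p)
    by_cases! hx : ∃ x ∈ Set.Ico p (p + min l m), x ∈ W i
    · obtain ⟨x, hxp, hxW⟩ := hx
      obtain ⟨q, h, hlt, hq⟩ := exists_Ico_subset_far hxp
      have hh : h ∉ C := fun hh => by
        have hh' : h + 1 + (h + 1) ∈ C := hadd _ (hadd _ hh _ hone) _ (hadd _ hh _ hone)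
        exact hlm (hlower hlt.le (hadd _ hh' _ hh'))
      refine ⟨_, ⟨q, h, hh, rfl⟩, fun y hy => ⟨hsub (hq hy).1, fun hyW => hh ?_⟩⟩
      have hdist : U.dist x y < min l m := by
        have := (hq hy).1
        simp only [Set.mem_Ico] at this hxp
        rw [dist_lt_iff]
        grind
      exact hlower (hq hy).2 (hWm x hxW y hyW (hdist.trans_le (min_le_right l m)))
    · exact ⟨_, ⟨p, _, hlm, rfl⟩, fun y hy => ⟨hsub hy, hx y hy⟩⟩

theorem exists_cover_of_cdLE_monadic_FD {C : Set U.HNat} (h : CDLE (U.monadic C) U.FD)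
    {a : ℕ → U.HNat} (ha : Antitone a) (hC : C = {x | ∀ n, x < a n}) :
    ∃ W : ℕ → Set U.HNat, (∀ x, ∃ i, x ∈ W i) ∧
      ∀ i, ∃ n, ∀ x ∈ W i, ∀ y ∈ W i, U.dist x y < a n → U.dist x y ∈ C := by
  obtain ⟨θ, hθ, hred⟩ := h
  let R (n : ℕ) (z w : U.Obj (.prod .nat (.set .nat))) : Prop :=
    U.dist (U.fst z) (U.fst w) < a n ∧ n ≤ diffCard (U.snd z) (U.snd w)
  have hR (n : ℕ) : U.IsInternal {q : U.Obj (.prod _ _) | R n (U.fst q) (U.snd q)} :=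
    IsInternal.prod_rel (R := fun x y => U.dist x y < a n) (S := fun S T => n ≤ diffCard S T)
      (isInternal_setOf_dist_lt (a n)) (isInternal_setOf_le_diffCard n)
  have hanti : Antitone R := fun m n hmn z w h =>
    ⟨h.1.trans_le (ha hmn), (Nat.cast_le.2 hmn).trans h.2⟩
  have hfin (x y : U.HNat) : U.dist x y ∈ C ↔
      diffCard (θ ⟨x, trivial⟩).1 (θ ⟨y, trivial⟩).1 < ⊤ :=
    (hred ⟨x, trivial⟩ ⟨y, trivial⟩).trans FD_rel_iff
  have hgraph : ∀ z ∈ graph θ, ∀ w ∈ graph θ, ∃ n, ¬ R n z w := by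
    rintro _ ⟨x, rfl⟩ _ ⟨y, rfl⟩
    by_contra! h
    simp only [R, fst_pair, snd_pair] at h
    exact ((hfin x y).1 (hC ▸ fun n => (h n).1)).ne
      (ENat.eq_top_iff_forall_ge.2 fun n => (h n).2)
  obtain ⟨A, -, hcover, hA⟩ := hθ.exists_internal_cover hR hanti hgraph
  let W (i : ℕ) : Set U.HNat := {x | U.pair x (θ ⟨x, trivial⟩).1 ∈ A i}
  refine ⟨W, fun x => (?_ : ∃ i, U.pair x _ ∈ A i),
    fun i => (hA i).imp fun n hn x hx y hy hxy => (hfin x y).2 ?_⟩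
  · exact Set.mem_iUnion.1 (hcover ⟨⟨x, trivial⟩, rfl⟩)
  have h := hn _ hx _ hy
  simp only [R, fst_pair, snd_pair, not_and, not_le] at h
  exact (h hxy).trans_le le_top

theorem not_cdLE_monadic_FD {C : Set U.HNat} (hadd : U.IsAdditive C)
    (hC : U.IsCountablyCoinitialCut C) : ¬ CDLE (U.monadic C) U.FD := by
  intro h
  obtain ⟨a, ha, hCa⟩ := id hC
  have haC (n : ℕ) : a n ∉ C := fun h => lt_irrefl (a n) ((hCa ▸ h) n)
  obtain ⟨W, hcover, hW⟩ :=
    exists_cover_of_cdLE_monadic_FD h (strictAnti_nat_of_succ_lt ha).antitone hCa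
  obtain ⟨x, hx⟩ := exists_forall_notMem_of_dist_mem hC.isLowerSet hadd hC.one_mem
    (fun h => haC 0 (h ▸ Set.mem_univ _)) fun i => (hW i).elim fun n hn => ⟨a n, haC n, hn⟩
  exact (hcover x).elim hx

end Universe

/-! ## Boxes of words -/

theorem exists_constant_on_box (N t : ℕ) (κ : Type*) [Finite κ] [Nonempty κ] :
    ∃ K : ℕ, ∀ c : (Fin N → Fin K) → κ, ∃ e : Fin N → Fin t → Fin K,
      (∀ i, Function.Injective (e i)) ∧ ∃ b, ∀ w : Fin N → Fin t, c (fun i => e i (w i)) = b := by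
  classical
  have := Fintype.ofFinite κ
  induction N with
  | zero =>
    exact ⟨0, fun c => ⟨finZeroElim, finZeroElim, c finZeroElim,
      fun w => congrArg c (Subsingleton.elim _ _)⟩⟩
  | succ N ih =>
    obtain ⟨K, hK⟩ := ih
    let K' := max K (Fintype.card ((Fin N → Fin K) → κ) * t)
    refine ⟨K', fun c => ?_⟩
    let slice (a : Fin K') (w : Fin N → Fin K) : κ :=
      c (Fin.cons a fun i => Fin.castLE (le_max_left _ _) (w i))
    obtain ⟨q, hq⟩ := Fintype.exists_le_card_fiber_of_mul_le_card slice
      ((le_max_right _ _).trans_eq (Fintype.card_fin K').symm)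
    obtain ⟨e, he, b, hb⟩ := hK q
    obtain ⟨ι⟩ : Nonempty (Fin t ↪ {a // a ∈ Finset.univ.filter fun a => slice a = q}) :=
      Function.Embedding.nonempty_of_card_le (by rwa [Fintype.card_fin, Fintype.card_coe])
    refine ⟨Fin.cons (fun j => ι j) fun i j => Fin.castLE (le_max_left _ _) (e i j),
      Fin.cases (fun j j' h => ι.injective (Subtype.ext h))
        fun i j j' h => he i (Fin.castLE_injective (le_max_left _ _ : K ≤ K') h), b, fun w => ?_⟩
    have hslice : slice (ι (w 0)) = q := (Finset.mem_filter.1 (ι (w 0)).2).2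
    rw [← hb fun i => w i.succ, ← congrFun hslice]
    exact congrArg c (funext <| Fin.cases rfl fun i => rfl)

theorem encard_symmDiff_graphOn_univ {ι α : Type*} [Fintype ι] [DecidableEq α] (f g : ι → α) :
    (symmDiff (Set.univ.graphOn f) (Set.univ.graphOn g)).encard = 2 * hammingDist f g := by
  have hdiff (f g : ι → α) :
      (Set.univ.graphOn f \ Set.univ.graphOn g).encard = hammingDist f g := by
    have himage : Set.univ.graphOn f \ Set.univ.graphOn g =
        (fun i => (i, f i)) '' (Finset.univ.filter fun i => f i ≠ g i) := by
      ext ⟨i, a⟩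
      simp only [Set.mem_sdiff, Set.mem_graphOn, Set.mem_univ, true_and, Set.mem_image,
        Finset.coe_filter, Finset.mem_univ, Set.mem_ofPred_eq, Prod.mk.injEq]
      grind
    rw [himage, Function.Injective.encard_image fun i j h => congrArg Prod.fst h,
      Set.encard_coe_eq_coe_finsetCard, hammingDist]
  rw [Set.symmDiff_def, Set.encard_union_eq disjoint_sdiff_sdiff, hdiff, hdiff,
    hammingDist_comm g f, two_mul]

section LipschitzWords

variable {M : Type*} [AddCommMonoid M] [LinearOrder M] {a : M}

theorem le_add_hammingDist_nsmul [IsOrderedAddMonoid M] {ι α : Type*} [Fintype ι] [DecidableEq α]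
    {g : (ι → α) → M} (hg : ∀ w w', hammingDist w w' ≤ 1 → g w ≤ g w' + a) (w w' : ι → α) :
    g w ≤ g w' + hammingDist w w' • a := by
  classical
  induction hd : hammingDist w w' generalizing w with
  | zero => simp [hammingDist_eq_zero.1 hd]
  | succ d ih =>
    obtain ⟨i, hi⟩ := Function.ne_iff.1 (hammingDist_pos.1 (by omega : 0 < hammingDist w w'))
    let w'' := Function.update w i (w' i)
    have hw : hammingDist w w'' ≤ 1 := by
      refine (Finset.card_le_card (t := {i}) fun j hj => ?_).trans_eq (Finset.card_singleton i)
      by_contra hne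
      simp_all [w'']
    have hw' : hammingDist w'' w' = d := by
      have herase : (Finset.univ.filter fun j => w'' j ≠ w' j) =
          (Finset.univ.filter fun j => w j ≠ w' j).erase i := by
        ext j
        by_cases hj : j = i <;> simp_all [w'']
      rw [hammingDist, herase, Finset.card_erase_of_mem (by simpa using hi)]
      exact Nat.sub_eq_of_eq_add hd
    calc g w ≤ g w'' + a := hg _ _ hw
      _ ≤ g w' + d • a + a := add_le_add_left (ih _ hw') a
      _ = g w' + (d + 1) • a := by rw [succ_nsmul, add_assoc]

theorem exists_add_nsmul_le_of_separated [IsOrderedAddMonoid M] {ι : Type*} {x : ι → M} {n : ℕ}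
    (s : Finset ι) (hs : s.card = n + 1)
    (hx : ∀ i ∈ s, ∀ j ∈ s, i ≠ j → x i + a ≤ x j ∨ x j + a ≤ x i) :
    ∃ i ∈ s, ∃ j ∈ s, x i + n • a ≤ x j := by
  classical
  induction n generalizing s with
  | zero =>
    obtain ⟨i, rfl⟩ := Finset.card_eq_one.1 hs
    exact ⟨i, by simp⟩
  | succ n ih =>
    obtain ⟨k, hk, hmax⟩ := s.exists_max_image x (Finset.card_pos.1 (by omega))
    obtain ⟨i, hi, j, hj, hij⟩ := ih (s.erase k) (by rw [Finset.card_erase_of_mem hk]; omega)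
      fun i hi j hj => hx i (Finset.mem_of_mem_erase hi) j (Finset.mem_of_mem_erase hj)
    have hjs := Finset.mem_of_mem_erase hj
    have hjk : x j + a ≤ x k := (hx j hjs k hk (Finset.ne_of_mem_erase hj)).elim id fun h =>
      (add_le_add_left (hmax j hjs) a).trans (h.trans (hmax j hjs))
    refine ⟨i, Finset.mem_of_mem_erase hi, k, hk, ?_⟩
    rw [succ_nsmul, ← add_assoc]
    exact (add_le_add_left hij a).trans hjk

theorem exists_ne_lt_add_of_lipschitz [IsOrderedCancelAddMonoid M] {N : ℕ} (ha : 0 < a)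
    {g : (Fin N → Fin (N + 2)) → M}
    (hg : ∀ w w', hammingDist w w' ≤ 1 → g w ≤ g w' + a) :
    ∃ j k : Fin (N + 2), j ≠ k ∧ g (fun _ => j) < g (fun _ => k) + a ∧
      g (fun _ => k) < g (fun _ => j) + a := by
  by_contra! h
  obtain ⟨j, -, k, -, hjk⟩ := exists_add_nsmul_le_of_separated (a := a) (n := N + 1)
    (x := fun j => g fun _ => j) Finset.univ (Finset.card_fin _) fun j _ k _ hne =>
      or_iff_not_imp_right.2 fun hkj => h j k hne (not_le.1 hkj)
  refine ((le_add_hammingDist_nsmul hg (fun _ => k) fun _ => j).trans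
    (add_le_add_right (nsmul_le_nsmul_left ha.le ?_) _)).not_gt
      ((add_lt_add_right (nsmul_lt_nsmul_left ha N.lt_succ_self) _).trans_le hjk)
  exact hammingDist_le_card_fintype.trans_eq (Fintype.card_fin N)

end LipschitzWords

namespace Universe

variable {U : Universe.{u}} {τ : Ty}

/-! ## Nonreducibility of `FD` to cofinal monadic relations -/

theorem exists_hyperfinite_cube {ι α : Type*} [Finite α] [Fintype ι] [DecidableEq α]
    {v : ℕ → U.HNat} (hv : Function.Injective v) :
    ∃ S : (ι → α) → U.Obj (.set .nat), (∀ w, S w ∈ U.hyperfinite) ∧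
      ∀ w w', diffCard (S w) (S w') = 2 * hammingDist w w' := by
  have := Encodable.ofCountable (ι × α)
  have hinj : Function.Injective fun p : ι × α => v (Encodable.encode p) :=
    hv.comp Encodable.encode_injective
  choose S hS hSv using fun w : ι → α =>
    U.exists_hyperfinite_extent_eq (((Set.univ.graphOn w).toFinite).image fun p =>
      v (Encodable.encode p))
  refine ⟨S, hS, fun w w' => ?_⟩
  rw [diffCard, hSv, hSv, ← Set.image_symmDiff hinj, hinj.encard_image,
    encard_symmDiff_graphOn_univ]

theorem exists_hyperfinite_cube_in_piece {v : ℕ → U.HNat} (hv : Function.Injective v)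
    {T : ℕ → Set (U.Obj (.set .nat))} {k : ℕ} (hT : U.hyperfinite ⊆ ⋃ i ≤ k, T i) (N t : ℕ) :
    ∃ i ≤ k, ∃ S : (Fin N → Fin t) → U.Obj (.set .nat), (∀ w, S w ∈ T i) ∧
      ∀ w w', diffCard (S w) (S w') = 2 * hammingDist w w' := by
  obtain ⟨K, hK⟩ := exists_constant_on_box N t (Fin (k + 1))
  obtain ⟨S, hS, hdiff⟩ := exists_hyperfinite_cube (ι := Fin N) (α := Fin K) hv
  have hpiece (w : Fin N → Fin K) : ∃ i : Fin (k + 1), S w ∈ T i := by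
    obtain ⟨i, hik, hi⟩ := Set.mem_iUnion₂.1 (hT (hS w))
    exact ⟨⟨i, Nat.lt_succ_of_le hik⟩, hi⟩
  choose c hc using hpiece
  obtain ⟨e, he, i, hi⟩ := hK c
  refine ⟨i, Nat.le_of_lt_succ i.2, fun w => S fun n => e n (w n), fun w => hi w ▸ hc _, ?_⟩
  intro w w'
  rw [hdiff, hammingDist_comp e he]

theorem IsCD.exists_cover_dist_lt {G : Set (U.Obj (.prod (.set τ) .nat))} (hG : U.IsCD G)
    {a : ℕ → U.HNat} (ha : Monotone a) (k : ℕ)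
    (hGa : ∀ z ∈ G, ∀ w ∈ G, diffCard (U.fst z) (U.fst w) < k →
      ∃ n, U.dist (U.snd z) (U.snd w) < a n) :
    ∃ A : ℕ → Set (U.Obj (.prod (.set τ) .nat)), (∀ i, U.IsInternal (A i)) ∧ G ⊆ ⋃ i, A i ∧
      ∀ i, ∃ n, ∀ z ∈ A i, ∀ w ∈ A i, diffCard (U.fst z) (U.fst w) < k →
        U.dist (U.snd z) (U.snd w) < a n := by
  obtain ⟨A, hA, hcover, hlt⟩ := hG.exists_internal_cover
    (R := fun n z w => ¬ k ≤ diffCard (U.fst z) (U.fst w) ∧ ¬ U.dist (U.snd z) (U.snd w) < a n)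
    (fun n => IsInternal.prod_rel (R := fun S T => ¬ k ≤ diffCard S T)
      (S := fun x y => ¬ U.dist x y < a n) (isInternal_setOf_le_diffCard k).compl
      (isInternal_setOf_dist_lt (a n)).compl)
    (fun m n hmn z w h => ⟨h.1, fun hlt => h.2 (hlt.trans_le (ha hmn))⟩)
    fun z hz w hw => by
      by_contra! h
      obtain ⟨n, hn⟩ := hGa z hz w hw (h 0).1
      exact hn.not_ge (h n).2
  exact ⟨A, hA, hcover, fun i => (hlt i).imp fun n hn z hz w hw hzw =>
    by_contra fun h => hn z hz w hw ⟨hzw.not_ge, h⟩⟩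

theorem IsCD.exists_cover_diffCard_lt {G : Set (U.Obj (.prod (.set τ) .nat))} (hG : U.IsCD G)
    {l : U.HNat} (hGl : ∀ z ∈ G, ∀ w ∈ G, U.dist (U.snd z) (U.snd w) < l →
      diffCard (U.fst z) (U.fst w) < ⊤) :
    ∃ A : ℕ → Set (U.Obj (.prod (.set τ) .nat)), (∀ i, U.IsInternal (A i)) ∧ G ⊆ ⋃ i, A i ∧
      ∀ i, ∃ m : ℕ, ∀ z ∈ A i, ∀ w ∈ A i, U.dist (U.snd z) (U.snd w) < l →
        diffCard (U.fst z) (U.fst w) < m := by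
  obtain ⟨A, hA, hcover, hlt⟩ := hG.exists_internal_cover
    (R := fun m z w => m ≤ diffCard (U.fst z) (U.fst w) ∧ U.dist (U.snd z) (U.snd w) < l)
    (fun m => IsInternal.prod_rel (R := fun S T => m ≤ diffCard S T)
      (S := fun x y => U.dist x y < l) (isInternal_setOf_le_diffCard m)
      (isInternal_setOf_dist_lt l))
    (fun m n hmn z w h => ⟨(Nat.cast_le.2 hmn).trans h.1, h.2⟩)
    fun z hz w hw => by
      by_contra! h
      exact (hGl z hz w hw (h 0).2).ne (ENat.eq_top_iff_forall_ge.2 fun m => (h m).1)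
  exact ⟨A, hA, hcover, fun i => (hlt i).imp fun m hm z hz w hw hzw =>
    not_le.1 fun h => hm z hz w hw ⟨h, hzw⟩⟩

theorem exists_internal_cover_of_cdLE_FD_monadic {C : Set U.HNat} (h : CDLE U.FD (U.monadic C))
    {a : ℕ → U.HNat} (ha : Monotone a) (hC : C = {x | ∃ n, x < a n}) :
    ∃ A : ℕ → Set (U.Obj (.prod (.set .nat) .nat)), (∀ i, U.IsInternal (A i)) ∧
      (U.hyperfinite ⊆ ⋃ i, U.fst '' A i) ∧ ∀ i, ∃ (l : U.HNat) (m : ℕ), ∀ z ∈ A i, ∀ w ∈ A i,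
        (diffCard (U.fst z) (U.fst w) < 3 → U.dist (U.snd z) (U.snd w) < l) ∧
        (m ≤ diffCard (U.fst z) (U.fst w) → l ≤ U.dist (U.snd z) (U.snd w)) := by
  obtain ⟨θ, hθ, hred⟩ := h
  have hfin : ∀ z ∈ graph θ, ∀ w ∈ graph θ,
      (diffCard (U.fst z) (U.fst w) < ⊤ ↔ ∃ n, U.dist (U.snd z) (U.snd w) < a n) := by
    rintro _ ⟨S, rfl⟩ _ ⟨T, rfl⟩
    simp only [fst_pair, snd_pair]
    exact FD_rel_iff.symm.trans ((hred S T).trans (iff_of_eq (congrArg (_ ∈ ·) hC)))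
  obtain ⟨A, hA, hcoverA, hlip⟩ := hθ.exists_cover_dist_lt ha 3 fun z hz w hw h =>
    (hfin z hz w hw).1 (h.trans_le le_top)
  choose n hn using hlip
  choose B hB hcoverB hsep using fun n => hθ.exists_cover_diffCard_lt (l := a n)
    fun z hz w hw h => (hfin z hz w hw).2 ⟨n, h⟩
  choose m hm using hsep
  refine ⟨fun i => A i.unpair.1 ∩ B (n i.unpair.1) i.unpair.2, fun i => (hA _).inter (hB _ _),
    fun S hS => ?_, fun i => ⟨a (n i.unpair.1), m (n i.unpair.1) i.unpair.2, fun z hz w hw => ?_⟩⟩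
  · obtain ⟨i, hi⟩ := Set.mem_iUnion.1 (hcoverA ⟨⟨S, hS⟩, rfl⟩)
    obtain ⟨j, hj⟩ := Set.mem_iUnion.1 (hcoverB (n i) ⟨⟨S, hS⟩, rfl⟩)
    exact Set.mem_iUnion.2 ⟨Nat.pair i j, _, by simpa using ⟨hi, hj⟩, U.fst_pair _ _⟩
  · exact ⟨hn _ z hz.1 w hw.1, fun h => not_lt.1 fun hlt => (hm _ _ z hz.2 w hw.2 hlt).not_ge h⟩

theorem not_cdLE_FD_monadic {C : Set U.HNat} (hC : U.IsCountablyCofinalCut C) :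
    ¬ CDLE U.FD (U.monadic C) := by
  intro h
  obtain ⟨a, ha, hCa⟩ := hC
  have hmono : StrictMono a := strictMono_nat_of_lt_succ ha
  obtain ⟨A, hA, hcover, hlm⟩ := exists_internal_cover_of_cdLE_FD_monadic h hmono.monotone hCa
  choose l m hlm using hlm
  obtain ⟨k, hk⟩ :=
    (isInternal_hyperfinite U).exists_subset_biUnion (fun i => (hA i).image_fst) hcover
  let N := (Finset.range (k + 1)).sup m
  obtain ⟨i, hik, S, hS, hdiff⟩ := exists_hyperfinite_cube_in_piece hmono.injective hk N (N + 2)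
  choose z hz hzS using hS
  have hdist (w w' : Fin N → Fin (N + 2)) :
      diffCard (U.fst (z w)) (U.fst (z w')) = 2 * hammingDist w w' := by
    rw [hzS, hzS, hdiff]
  have hlip (w w' : Fin N → Fin (N + 2)) (hww' : hammingDist w w' ≤ 1) :
      U.dist (U.snd (z w)) (U.snd (z w')) < l i :=
    (hlm i _ (hz w) _ (hz w')).1 (by
      rw [hdist]
      exact_mod_cast (by omega : 2 * hammingDist w w' < 3))
  have hpos : 0 < l i := lt_of_le_of_lt zero_le (hlip (fun _ => 0) (fun _ => 0) (by simp))
  obtain ⟨j, j', hne, hj, hj'⟩ := exists_ne_lt_add_of_lipschitz hpos (g := fun w => U.snd (z w))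
    fun w w' h => ((dist_lt_iff U).1 (hlip w w' h)).1.le
  have hN : hammingDist (fun _ : Fin N => j) (fun _ => j') = N := by simp [hammingDist, hne]
  have hm : m i ≤ N := Finset.le_sup (Finset.mem_range.2 (Nat.lt_succ_of_le hik))
  refine ((hlm i _ (hz _) _ (hz _)).2 ?_).not_gt ((dist_lt_iff U).2 ⟨hj, hj'⟩)
  rw [hdist, hN]
  exact_mod_cast (by omega : m i ≤ 2 * N)

end Universe

end NSA

theorem mainTheorem8_general (U : NSA.Universe.{u}) :
    (∀ C : Set U.HNat, U.IsAdditive C → U.IsCountablyCofinalCut C →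
      NSA.Universe.BorelLE (U.monadic C) U.FD) ∧
    (∀ C : Set U.HNat, U.IsCountablyCofinalCut C → ¬ NSA.Universe.CDLE U.FD (U.monadic C)) ∧
    (∀ C : Set U.HNat, U.IsAdditive C → U.IsCountablyCoinitialCut C →
      ¬ NSA.Universe.CDLE (U.monadic C) U.FD) :=
  ⟨fun _ => NSA.Universe.borelLE_monadic_FD, fun _ => NSA.Universe.not_cdLE_FD_monadic,
    fun _ => NSA.Universe.not_cdLE_monadic_FD⟩

theorem mainTheorem8 (U : NSA.Universe.{u}) :
    (∀ C : Set U.HNat, U.IsAdditive C → U.IsCountablyCofinalCut C →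
      NSA.Universe.BorelLE (U.monadic C) U.FD) ∧
    (∀ C : Set U.HNat, U.IsAdditive C → U.IsCountablyCofinalCut C →
      NSA.Universe.BorelLT (U.monadic C) U.FD) ∧
    (∀ C : Set U.HNat, U.IsAdditive C → U.IsCountablyCoinitialCut C →
      ¬ NSA.Universe.CDLE (U.monadic C) U.FD) := by
  obtain ⟨hle, hnot, hcoinitial⟩ := mainTheorem8_general U
  exact ⟨hle, fun C hadd hC => ⟨hle C hadd hC, fun h => hnot C hC h.cdLE⟩, hcoinitial⟩
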